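/- For $n,m\in\mathbb N$, $n, m\ge 1$, let $ABC$ be an equilateral triangle with side length $n$ and centre $M$. The instance $T_{n,m}$ consists of the *base vertices*, which divide each side of the triangle into $n$ segments of length $1$ (corners included), and of the *internal vertices*, which divide each of the segments $AM$, $BM$, $CM$ into $m$ segments of length $\gamma=\frac{n}{\sqrt3\,m}$ ($M$ included, $A,B,C$ excluded). The modified instance $T'_{n,m}$ is obtained from $T_{n,m}$ by removing all internal vertices whose Euclidean distance to one of $A,B,C$ is less than $\max\{10,\,4+4\gamma\}$. Let $N_{n,m}$ be the number of vertices of $T'_{n,m}$. For a finite set $V$ of points in the plane with at least three elements, a tour is a cyclic order of $V$, its length is the sum of the Euclidean distances of consecutive points, and the subtour LP is $$\min\sum_{e}c_e x_e\ \text{ s.t. }\ 0\le x_e\le 1,\quad \sum_{e\in\delta(v)}x_e=2\ (v\in V),\quad \sum_{e\in E(K_V[X])}x_e\le |X|-1\ (\emptyset\ne X\subsetneq V),$$ where $e$ ranges over the edges of the complete graph $K_V$ on $V$ and $c_e$ is the Euclidean length of $e$. The integrality ratio of $V$ is the length of an optimum tour divided by the optimum value of the subtour LP. Let $\rho_{n,m}$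 be the integrality ratio of $T'_{n,m}$. Call $(n,m)$ admissible if $n\ge 40$, $m\ge 22$ and $n\le\frac32 m$. Then: 1. For all admissible $(n,m)$, $$\frac{4n+4n/\sqrt3-69}{3n+3n/\sqrt3}\ \le\ \rho_{n,m}\ \le\ \frac{4n+4n/\sqrt3-17}{3n+3n/\sqrt3-33}.$$ 2. $\rho_{n,m}\to\frac43$ as $n\to\infty$, uniformly over all $m$ with $n\le\frac32m$. 3. $\rho_{n,m}=\frac43-\Theta(1/n)$: there are constants $c,C>0$ with $\frac cn\le\frac43-\rho_{n,m}\le\frac Cn$ for all admissible $(n,m)$. 4. As long as $m=O(n)$, $\rho_{n,m}=\frac43-\Theta(1/N_{n,m})$: for every $\kappa\in\mathbb R$ there are constants $c,C>0$ with $\frac c{N_{n,m}}\le\frac43-\rho_{n,m}\le\frac C{N_{n,m}}$ for all admissible $(n,m)$ with $m\le\kappa n$. -/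

import Mathlib

open Filter Topology

noncomputable section

namespace TSP

/-! ### Tours and the subtour LP of a finite metric space -/

section Instance

variable (V : Type*) [MetricSpace V] [Fintype V]

/-- The lengths of all tours through the points of `V`.  A tour visits every point exactly once and
returns to its start; it is given by its successor map, a permutation all of whose points lie on one
cycle. -/
def tourLengths : Set ℝ :=
  {l | ∃ σ : Equiv.Perm V, σ.IsCycleOn Set.univ ∧ l = ∑ v, dist v (σ v)}

/-- The length of an optimum tour. -/
def optTour : ℝ := sInf (tourLengths V)

variable {V}

/-- The length of an edge, i.e. of an unordered pair of points. -/
def edgeLength : Sym2 V → ℝ := Sym2.lift ⟨fun v w => dist v w, fun v w => dist_comm v w⟩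

open scoped Classical in
/-- The edges of the complete graph on a set `X` of vertices: the unordered pairs of distinct
elements of `X`. -/
def edgesWithin (X : Finset V) : Finset (Sym2 V) := X.sym2.filter (fun e => ¬ e.IsDiag)

open scoped Classical in
/-- The edges of the complete graph on `V` that are incident to `v`. -/
def edgesAt (v : V) : Finset (Sym2 V) := (edgesWithin Finset.univ).filter (fun e => v ∈ e)

/-- Feasible solutions of the subtour LP.  The variables are indexed by the edges of the complete
graph on `V`; the values of `x` at the degenerate pairs `s(v, v)` are never used.  The subtour
constraint is imposed for the nonempty proper subsets of `V`. -/
structure IsSubtourFeasible (x : Sym2 V → ℝ) : Prop where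
  nonneg : ∀ e ∈ edgesWithin (Finset.univ : Finset V), 0 ≤ x e
  le_one : ∀ e ∈ edgesWithin (Finset.univ : Finset V), x e ≤ 1
  degree : ∀ v : V, ∑ e ∈ edgesAt v, x e = 2
  subtour : ∀ X : Finset V, X.Nonempty → X ≠ Finset.univ →
    ∑ e ∈ edgesWithin X, x e ≤ (X.card : ℝ) - 1

/-- The objective value of the subtour LP. -/
def lpValue (x : Sym2 V → ℝ) : ℝ := ∑ e ∈ edgesWithin (Finset.univ : Finset V), edgeLength e * x e

variable (V)

/-- The objective values of all feasible solutions of the subtour LP. -/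
def lpValues : Set ℝ := {l | ∃ x : Sym2 V → ℝ, IsSubtourFeasible x ∧ l = lpValue x}

/-- The optimum value of the subtour LP. -/
def optSubtourLP : ℝ := sInf (lpValues V)

/-- The integrality ratio of the subtour LP for the TSP instance `V`. -/
def integralityRatio : ℝ := optTour V / optSubtourLP V


/-! The two infima are minima (for the LP: as soon as there are at least three points). -/

theorem isLeast_optTour : IsLeast (tourLengths V) (optTour V) := by
  classical
  have hfin : (tourLengths V).Finite := by
    have : tourLengths V ⊆ Set.range (fun σ : Equiv.Perm V => ∑ v, dist v (σ v)) := by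
      rintro l ⟨σ, -, rfl⟩
      exact ⟨σ, rfl⟩
    exact (Set.finite_range _).subset this
  have hne : (tourLengths V).Nonempty := by
    obtain ⟨σ, hσ, -⟩ := (Set.finite_univ (α := V)).countable.exists_cycleOn
    exact ⟨_, σ, hσ, rfl⟩
  exact ⟨hne.csInf_mem hfin, fun l hl => csInf_le hfin.bddBelow hl⟩

theorem isLeast_optSubtourLP (hV : 3 ≤ Fintype.card V) :
    IsLeast (lpValues V) (optSubtourLP V) := by
  classical
  have hN : (3 : ℝ) ≤ Fintype.card V := by exact_mod_cast hV
  -- the constant solution shows that the feasible region is nonempty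
  have hfeas : IsSubtourFeasible (fun _ : Sym2 V => (2 : ℝ) / (Fintype.card V - 1)) := by
    refine ⟨fun _ _ => div_nonneg (by norm_num) (by linarith), fun _ _ => ?_, fun v => ?_,
      fun X hX hXu => ?_⟩
    · rw [div_le_one (by linarith)]
      linarith
    · have hE : edgesAt v = (Finset.univ.erase v).image (fun w => s(v, w)) := by
        ext e
        induction e using Sym2.ind with
        | _ a b =>
          simp only [edgesAt, edgesWithin, Finset.mem_filter, Finset.mem_sym2_iff, Finset.mem_univ,
            Sym2.mem_iff, Finset.mem_image, Finset.mem_erase, Sym2.mk_isDiag_iff, Sym2.eq_iff]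
          constructor
          · rintro ⟨⟨-, hab⟩, rfl | rfl⟩
            · exact ⟨b, ⟨Ne.symm hab, trivial⟩, Or.inl ⟨rfl, rfl⟩⟩
            · exact ⟨a, ⟨hab, trivial⟩, Or.inr ⟨rfl, rfl⟩⟩
          · rintro ⟨w, ⟨hw, -⟩, ⟨rfl, rfl⟩ | ⟨rfl, rfl⟩⟩
            · exact ⟨⟨fun _ _ => trivial, Ne.symm hw⟩, Or.inl rfl⟩
            · exact ⟨⟨fun _ _ => trivial, hw⟩, Or.inr rfl⟩
      have hc : (edgesAt v).card = Fintype.card V - 1 := by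
        rw [hE, Finset.card_image_of_injective, Finset.card_erase_of_mem (Finset.mem_univ v),
          Finset.card_univ]
        intro a b h
        have h' : a = b ∨ v = b ∧ a = v := by simpa using h
        rcases h' with h' | ⟨h1, h2⟩
        · exact h'
        · exact h2.trans h1
      rw [Finset.sum_const, hc, nsmul_eq_mul, Nat.cast_sub (by omega), Nat.cast_one]
      field_simp [show (Fintype.card V : ℝ) - 1 ≠ 0 by linarith]
    · have hE : edgesWithin X = X.offDiag.image (fun p => s(p.1, p.2)) := by
        ext e
        induction e using Sym2.ind with
        | _ a b =>
          simp only [edgesWithin, Finset.mem_filter, Finset.mk_mem_sym2_iff, Finset.mem_image,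
            Finset.mem_offDiag, Sym2.mk_isDiag_iff, Sym2.eq_iff, Prod.exists]
          grind
      have hc : (edgesWithin X).card = X.card.choose 2 := by
        rw [hE]
        exact Sym2.card_image_offDiag X
      have h1 : (1 : ℝ) ≤ X.card := by exact_mod_cast hX.card_pos
      have h2 : (X.card : ℝ) + 1 ≤ Fintype.card V := by
        exact_mod_cast Finset.card_lt_univ_of_notMem
          (Classical.choose_spec (by simpa [Finset.eq_univ_iff_forall] using hXu))
      rw [Finset.sum_const, hc, nsmul_eq_mul, Nat.cast_choose_two, mul_div_assoc', div_le_iff₀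
        (by linarith)]
      nlinarith
  -- feasible solutions that vanish at the degenerate pairs form a compact set
  let K : Set (Sym2 V → ℝ) := {x | IsSubtourFeasible x ∧ ∀ e, e.IsDiag → x e = 0}
  have hcongr : ∀ (x : Sym2 V → ℝ) (X : Finset V), ∀ e ∈ edgesWithin X,
      (if e.IsDiag then 0 else x e) = x e := by
    intro x X e he
    rw [if_neg (Finset.mem_filter.mp he).2]
  have htrunc : ∀ x : Sym2 V → ℝ, IsSubtourFeasible x →
      (fun e => if e.IsDiag then 0 else x e) ∈ K ∧
        lpValue (fun e => if e.IsDiag then 0 else x e) = lpValue x := by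
    intro x hx
    refine ⟨⟨⟨fun e he => ?_, fun e he => ?_, fun v => ?_, fun X h1 h2 => ?_⟩, fun e he => ?_⟩, ?_⟩
    · rw [hcongr x _ e he]
      exact hx.nonneg e he
    · rw [hcongr x _ e he]
      exact hx.le_one e he
    · rw [← hx.degree v]
      exact Finset.sum_congr rfl fun e he => hcongr x _ e (Finset.mem_filter.mp he).1
    · rw [Finset.sum_congr rfl (hcongr x X)]
      exact hx.subtour X h1 h2
    · simp [he]
    · exact Finset.sum_congr rfl fun e he => congrArg (edgeLength e * ·) (hcongr x _ e he)
  have hclosed : IsClosed K := by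
    have : K = (⋂ e ∈ edgesWithin (Finset.univ : Finset V), {x : Sym2 V → ℝ | 0 ≤ x e}) ∩
        (⋂ e ∈ edgesWithin (Finset.univ : Finset V), {x : Sym2 V → ℝ | x e ≤ 1}) ∩
        (⋂ v : V, {x : Sym2 V → ℝ | ∑ e ∈ edgesAt v, x e = 2}) ∩
        (⋂ X : Finset V, ⋂ _ : X.Nonempty, ⋂ _ : X ≠ Finset.univ,
          {x : Sym2 V → ℝ | ∑ e ∈ edgesWithin X, x e ≤ (X.card : ℝ) - 1}) ∩
        (⋂ e : Sym2 V, ⋂ _ : e.IsDiag, {x : Sym2 V → ℝ | x e = 0}) := by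
      ext x
      simp only [Set.mem_inter_iff, Set.mem_iInter, Set.mem_ofPred_eq]
      exact ⟨fun h => ⟨⟨⟨⟨h.1.1, h.1.2⟩, h.1.3⟩, h.1.4⟩, h.2⟩,
        fun h => ⟨⟨h.1.1.1.1, h.1.1.1.2, h.1.1.2, h.1.2⟩, h.2⟩⟩
    rw [this]
    refine ((((isClosed_biInter fun e _ => ?_).inter (isClosed_biInter fun e _ => ?_)).inter
      (isClosed_iInter fun v => ?_)).inter (isClosed_iInter fun X => isClosed_iInter fun _ =>
        isClosed_iInter fun _ => ?_)).inter (isClosed_iInter fun e => isClosed_iInter fun _ => ?_)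
    · exact isClosed_le (by fun_prop) (by fun_prop)
    · exact isClosed_le (by fun_prop) (by fun_prop)
    · exact isClosed_eq (by fun_prop) (by fun_prop)
    · exact isClosed_le (by fun_prop) (by fun_prop)
    · exact isClosed_eq (by fun_prop) (by fun_prop)
  have hK : IsCompact K := by
    refine (isCompact_univ_pi fun _ : Sym2 V => isCompact_Icc (a := (0 : ℝ)) (b := 1)).of_isClosed_subset
      hclosed fun x hx e _ => ?_
    by_cases he : e.IsDiag
    · simp [hx.2 e he]
    · have hm : e ∈ edgesWithin (Finset.univ : Finset V) :=
        Finset.mem_filter.mpr ⟨by simp, he⟩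
      exact ⟨hx.1.nonneg e hm, hx.1.le_one e hm⟩
  obtain ⟨y, hy, hmin⟩ := hK.exists_isMinOn ⟨_, (htrunc _ hfeas).1⟩
    (f := lpValue) (by unfold lpValue; fun_prop)
  have hleast : IsLeast (lpValues V) (lpValue y) := by
    refine ⟨⟨y, hy.1, rfl⟩, ?_⟩
    rintro l ⟨x, hx, rfl⟩
    rw [← (htrunc x hx).2]
    exact hmin (htrunc x hx).1
  rw [optSubtourLP, hleast.csInf_eq]
  exact hleast

end Instance

/-! ### The tetrahedron instances -/

/-- The Euclidean plane. -/
abbrev Plane : Type := EuclideanSpace ℝ (Fin 2)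

section Tetrahedron

variable (n m : ℕ)

/-- The points on the base side `a`, from `B` to `C`. -/
def ptA (i : ℕ) : Plane := !₂[(n : ℝ) - i / 2, i * √3 / 2]

/-- The points on the base side `b`, from `C` to `A`. -/
def ptB (i : ℕ) : Plane := !₂[(n : ℝ) / 2 - i / 2, ((n : ℝ) - i) * √3 / 2]

/-- The points on the base side `c`, from `A` to `B`. -/
def ptC (i : ℕ) : Plane := !₂[(i : ℝ), 0]

/-- The points on the internal segment `e`, from `A` to the centre `M`. -/
def ptE (j : ℕ) : Plane := !₂[(j : ℝ) * n / (2 * m), j * n / (2 * √3 * m)]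

/-- The points on the internal segment `f`, from `B` to the centre `M`. -/
def ptF (j : ℕ) : Plane := !₂[(n : ℝ) - j * n / (2 * m), j * n / (2 * √3 * m)]

/-- The points on the internal segment `g`, from `C` to the centre `M`. -/
def ptG (j : ℕ) : Plane := !₂[(n : ℝ) / 2, n * √3 / 2 - j * n / (√3 * m)]

/-- The corner `A` of the equilateral triangle with side length `n`. -/
def cornerA : Plane := ptC 0
/-- The corner `B`. -/
def cornerB : Plane := ptA n 0
/-- The corner `C`. -/
def cornerC : Plane := ptB n 0

open scoped Classical in
/-- The base vertices. -/
def baseVertices : Finset Plane :=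
  (Finset.range (n + 1)).image (ptA n) ∪ (Finset.range (n + 1)).image (ptB n) ∪
    (Finset.range (n + 1)).image ptC

open scoped Classical in
/-- The internal vertices. -/
def internalVertices : Finset Plane :=
  (Finset.Icc 1 m).image (ptE n m) ∪ (Finset.Icc 1 m).image (ptF n m) ∪
    (Finset.Icc 1 m).image (ptG n m)

open scoped Classical in
/-- The tetrahedron instance `T_{n,m}`. -/
def tetrahedron : Finset Plane := baseVertices n ∪ internalVertices n m

/-- The distance `γ = n / (√3 m)` of consecutive internal vertices. -/
def gam : ℝ := n / (√3 * m)

open scoped Classical in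
/-- The modified tetrahedron instance `T'_{n,m}`: the internal vertices whose distance to one of the
corners is less than `max {10, 4 + 4γ}` are removed from `T_{n,m}`. -/
def modTetrahedron : Finset Plane :=
  (tetrahedron n m).filter fun p => ¬ (p ∈ internalVertices n m ∧
    ∃ q ∈ ({cornerA, cornerB n, cornerC n} : Set Plane), dist q p < max 10 (4 + 4 * gam n m))

/-- The number of vertices of `T'_{n,m}`. -/
def numVertices : ℕ := (modTetrahedron n m).card

/-- The integrality ratio of `T'_{n,m}`. -/
def modRatio : ℝ := integralityRatio (modTetrahedron n m)

end Tetrahedron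

end TSP

end

noncomputable section

namespace TSP

section

open MeasureTheory

/-! ### Crossing numbers of a tour with concentric circles -/

section Crossing

variable {V : Type*} [Fintype V]

theorem exists_exit {σ : Equiv.Perm V} (hσ : σ.IsCycleOn Set.univ) {P : V → Prop}
    (h1 : ∃ v, P v) (h2 : ∃ v, ¬ P v) : ∃ v, P v ∧ ¬ P (σ v) := by
  by_contra! hcon
  obtain ⟨v, hv⟩ := h1
  obtain ⟨w, hw⟩ := h2
  have hf : (Set.univ : Set V).Finite := Set.toFinite _
  obtain ⟨k, hk⟩ := hσ.exists_pow_eq' hf (Set.mem_univ v) (Set.mem_univ w)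
  have : ∀ k : ℕ, P ((σ ^ k) v) := by
    intro k
    induction k with
    | zero => simpa using hv
    | succ k ih => rw [pow_succ', Equiv.Perm.mul_apply]; exact hcon _ ih
  exact hw (hk ▸ this k)

open scoped Classical in
/-- The number of steps of `σ` that leave the set `{v | P v}`. -/
def exits (σ : Equiv.Perm V) (P : V → Prop) : ℕ :=
  (Finset.univ.filter fun v => P v ∧ ¬ P (σ v)).card

open scoped Classical in
theorem exits_eq_entries (σ : Equiv.Perm V) (P : V → Prop) :
    exits σ P = (Finset.univ.filter fun v => ¬ P v ∧ P (σ v)).card := by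
  have h1 : (Finset.univ.filter fun v => P (σ v)).card = (Finset.univ.filter P).card := by
    refine Finset.card_bij (fun v _ => σ v) (by simp) (fun a _ b _ h => σ.injective h) ?_
    intro b hb
    exact ⟨σ.symm b, by simpa using hb, by simp⟩
  have h2 := Finset.card_filter_add_card_filter_not (s := Finset.univ.filter P) (fun v => P (σ v))
  have h3 := Finset.card_filter_add_card_filter_not (s := Finset.univ.filter fun v => P (σ v)) P
  rw [Finset.filter_filter, Finset.filter_filter] at h2 h3
  have h4 : (Finset.univ.filter fun v => P (σ v) ∧ P v) =
      Finset.univ.filter fun v => P v ∧ P (σ v) := by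
    ext; simp [and_comm]
  have h5 : (Finset.univ.filter fun v => P (σ v) ∧ ¬ P v) =
      Finset.univ.filter fun v => ¬ P v ∧ P (σ v) := by
    ext; simp [and_comm]
  rw [h4, h5] at h3
  unfold exits
  omega

theorem one_le_exits {σ : Equiv.Perm V} (hσ : σ.IsCycleOn Set.univ) {P : V → Prop}
    (h1 : ∃ v, P v) (h2 : ∃ v, ¬ P v) : 1 ≤ exits σ P := by
  classical
  obtain ⟨v, hv⟩ := exists_exit hσ h1 h2
  exact Finset.card_pos.mpr ⟨v, by simpa using hv⟩

theorem exits_one_unique {σ : Equiv.Perm V} {P : V → Prop} (h : exits σ P = 1) {v w : V}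
    (hv : P v) (hv' : ¬ P (σ v)) (hw : P w) (hw' : ¬ P (σ w)) : v = w := by
  classical
  exact Finset.card_le_one.mp h.le v (by simp [hv, hv']) w (by simp [hw, hw'])

theorem entries_one_unique {σ : Equiv.Perm V} {P : V → Prop} (h : exits σ P = 1) {v w : V}
    (hv : ¬ P v) (hv' : P (σ v)) (hw : ¬ P w) (hw' : P (σ w)) : v = w := by
  classical
  rw [exits_eq_entries] at h
  exact Finset.card_le_one.mp h.le v (by simp [hv, hv']) w (by simp [hw, hw'])

/-- If the tour enters and leaves two concentric discs exactly once, and if the annulus between them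
meets three lines, then some step of the tour in the annulus changes the line. -/
theorem exists_jump {σ : Equiv.Perm V} (hσ : σ.IsCycleOn Set.univ) {f : V → ℝ} {l : V → Fin 3}
    {s s' : ℝ} (h : exits σ (fun v => f v ≤ s) = 1) (h' : exits σ (fun v => f v ≤ s') = 1)
    (hl : ∀ i, ∃ v, l v = i ∧ s < f v ∧ f v ≤ s') :
    ∃ v, s < f v ∧ f v ≤ s' ∧ s < f (σ v) ∧ f (σ v) ≤ s' ∧ l v ≠ l (σ v) := by
  by_contra! hcon
  have key : ∀ i, ∃ v, l v = i ∧ s < f v ∧ f v ≤ s' ∧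
      (f (σ v) ≤ s ∨ s' < f (σ v)) := by
    intro i
    obtain ⟨v, ⟨hv1, hv2, hv3⟩, hv4⟩ := exists_exit hσ
      (P := fun v => l v = i ∧ s < f v ∧ f v ≤ s') (hl i) (by
        obtain ⟨w, hw, -⟩ := hl (i + 1)
        exact ⟨w, fun h => by rw [hw] at h; exact absurd h.1 (by fin_cases i <;> decide)⟩)
    refine ⟨v, hv1, hv2, hv3, ?_⟩
    by_contra! hc
    exact hv4 ⟨(hcon v hv2 hv3 hc.1 hc.2).symm.trans hv1, hc.1, hc.2⟩
  choose v hv1 hv2 hv3 hv4 using key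
  have hlow : ∀ i j, f (σ (v i)) ≤ s → f (σ (v j)) ≤ s → i = j := by
    intro i j hi hj
    rw [← hv1 i, ← hv1 j, entries_one_unique h (not_le.mpr (hv2 i)) hi (not_le.mpr (hv2 j)) hj]
  have hup : ∀ i j, s' < f (σ (v i)) → s' < f (σ (v j)) → i = j := by
    intro i j hi hj
    rw [← hv1 i, ← hv1 j, exits_one_unique h' (hv3 i) (not_le.mpr hi) (hv3 j) (not_le.mpr hj)]
  rcases hv4 0 with h0 | h0 <;> rcases hv4 1 with h1 | h1 <;> rcases hv4 2 with h2 | h2 <;>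
    first
    | exact absurd (hlow 0 1 h0 h1) (by decide)
    | exact absurd (hlow 0 2 h0 h2) (by decide)
    | exact absurd (hlow 1 2 h1 h2) (by decide)
    | exact absurd (hup 0 1 h0 h1) (by decide)
    | exact absurd (hup 0 2 h0 h2) (by decide)
    | exact absurd (hup 1 2 h1 h2) (by decide)

/-- The radii at which the tour leaves the disc exactly once. -/
def thinRadii (σ : Equiv.Perm V) (f : V → ℝ) (R : ℝ) : Set ℝ :=
  {s | 0 ≤ s ∧ s < R ∧ exits σ (fun v => f v ≤ s) = 1}

theorem exits_eq_sum (σ : Equiv.Perm V) (f : V → ℝ) (s : ℝ) :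
    (exits σ (fun v => f v ≤ s) : ℝ) =
      ∑ v, (Set.Ico (f v) (f (σ v))).indicator (fun _ => (1 : ℝ)) s := by
  classical
  rw [exits, Finset.card_filter]
  push_cast
  refine Finset.sum_congr rfl fun v _ => ?_
  simp [Set.indicator_apply, Set.mem_Ico]

theorem measurableSet_thinRadii (σ : Equiv.Perm V) (f : V → ℝ) (R : ℝ) :
    MeasurableSet (thinRadii σ f R) := by
  have : thinRadii σ f R = Set.Ico 0 R ∩ {s | ∑ v, (Set.Ico (f v) (f (σ v))).indicator
      (fun _ => (1 : ℝ)) s = 1} := by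
    ext s
    simp only [thinRadii, Set.mem_ofPred_eq, Set.mem_inter_iff, Set.mem_Ico, ← exits_eq_sum, and_assoc]
    norm_cast
  rw [this]
  refine measurableSet_Ico.inter (measurableSet_eq_fun ?_ measurable_const)
  exact Finset.measurable_sum _ fun v _ => measurable_const.indicator measurableSet_Ico

/-- The total radial variation of a tour, truncated at radius `R`. -/
theorem sum_variation_ge {σ : Equiv.Perm V} (hσ : σ.IsCycleOn Set.univ) {f : V → ℝ} {R : ℝ}
    (hR : 0 < R) (h0 : ∀ v, 0 ≤ f v) (hz : ∃ v, f v = 0) (hfar : ∃ v, R ≤ f v) :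
    4 * R - 2 * volume.real (thinRadii σ f R) ≤ ∑ v, |min (f v) R - min (f (σ v)) R| := by
  classical
  have hS := measurableSet_thinRadii σ f R
  have hsub : thinRadii σ f R ⊆ Set.Ico 0 R := fun s hs => ⟨hs.1, hs.2.1⟩
  have hint : ∀ v, IntegrableOn ((Set.Ico (f v) (f (σ v))).indicator (fun _ => (1 : ℝ)))
      (Set.Ico 0 R) := fun v =>
    (integrable_const (1 : ℝ) (μ := volume.restrict (Set.Ico 0 R))).indicator measurableSet_Ico
  have hone : ∫ s in Set.Ico 0 R, (2 - (thinRadii σ f R).indicator (fun _ => (1 : ℝ)) s) =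
      2 * R - volume.real (thinRadii σ f R) := by
    rw [integral_sub (integrable_const _) ((integrable_const (1 : ℝ)).indicator hS),
      setIntegral_indicator hS, Set.inter_eq_self_of_subset_right hsub]
    simp [hR.le, mul_comm]
  have hle : ∫ s in Set.Ico 0 R, (2 - (thinRadii σ f R).indicator (fun _ => (1 : ℝ)) s) ≤
      ∫ s in Set.Ico 0 R, ∑ v, (Set.Ico (f v) (f (σ v))).indicator (fun _ => (1 : ℝ)) s := by
    refine setIntegral_mono_on ((integrable_const _).sub ((integrable_const (1 : ℝ)).indicator hS))
      (integrable_finsetSum _ fun v _ => hint v) measurableSet_Ico fun s hs => ?_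
    rw [← exits_eq_sum]
    have h1 : 1 ≤ exits σ (fun v => f v ≤ s) := by
      refine one_le_exits hσ ?_ ?_
      · obtain ⟨v, hv⟩ := hz
        exact ⟨v, hv.le.trans hs.1⟩
      · obtain ⟨v, hv⟩ := hfar
        exact ⟨v, not_le.mpr (hs.2.trans_le hv)⟩
    by_cases hm : s ∈ thinRadii σ f R
    · rw [Set.indicator_of_mem hm]
      have : (1 : ℝ) ≤ exits σ (fun v => f v ≤ s) := by exact_mod_cast h1
      linarith
    · rw [Set.indicator_of_notMem hm]
      have h2 : exits σ (fun v => f v ≤ s) ≠ 1 := fun h => hm ⟨hs.1, hs.2, h⟩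
      have : (2 : ℝ) ≤ exits σ (fun v => f v ≤ s) := by
        exact_mod_cast (show 2 ≤ exits σ (fun v => f v ≤ s) by omega)
      linarith
  rw [hone, integral_finsetSum _ fun v _ => hint v] at hle
  have hterm : ∀ v, ∫ s in Set.Ico 0 R, (Set.Ico (f v) (f (σ v))).indicator (fun _ => (1 : ℝ)) s =
      max 0 (min (f (σ v)) R - min (f v) R) := by
    intro v
    rw [setIntegral_indicator measurableSet_Ico, Set.Ico_inter_Ico]
    simp only [integral_const, smul_eq_mul, mul_one, measureReal_restrict_apply_univ]
    rw [Real.volume_real_Ico]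
    rw [max_eq_right (h0 v), min_comm R, max_comm]
    rcases le_total (f v) R with h | h
    · rw [min_eq_left h]
    · rw [min_eq_right h, max_eq_left, max_eq_left] <;>
        linarith [min_le_right (f (σ v)) R]
  have hsum : ∑ v, (min (f (σ v)) R - min (f v) R) = 0 := by
    rw [Finset.sum_sub_distrib, sub_eq_zero]
    exact Equiv.sum_comp σ fun v => min (f v) R
  have habs : ∑ v, |min (f v) R - min (f (σ v)) R| =
      ∑ v, (2 * max 0 (min (f (σ v)) R - min (f v) R) - (min (f (σ v)) R - min (f v) R)) := by
    refine Finset.sum_congr rfl fun v _ => ?_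
    rcases le_total (min (f v) R) (min (f (σ v)) R) with h | h
    · rw [abs_of_nonpos (by linarith), max_eq_right (by linarith)]
      ring
    · rw [abs_of_nonneg (by linarith), max_eq_left (by linarith)]
      ring
  rw [habs, Finset.sum_sub_distrib, hsum, ← Finset.mul_sum,
    Finset.sum_congr rfl fun v _ => (hterm v).symm]
  linarith

theorem exists_min_thinRadii {σ : Equiv.Perm V} {f : V → ℝ} {R t : ℝ} (ht : 0 ≤ t)
    (h : (thinRadii σ f R ∩ Set.Ici t).Nonempty) :
    ∃ s ∈ thinRadii σ f R, t ≤ s ∧ thinRadii σ f R ∩ Set.Ici t ⊆ Set.Ici s := by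
  classical
  let c : ℝ → ℕ := fun s => (Finset.univ.filter fun v => f v ≤ s).card
  have hmem := Function.argminOn_mem c (thinRadii σ f R ∩ Set.Ici t) h
  have hmin : ∀ s' ∈ thinRadii σ f R ∩ Set.Ici t, c (Function.argminOn c (thinRadii σ f R ∩ Set.Ici t) h) ≤ c s' :=
    fun s' hs' => Function.argminOn_le c _ hs'
  obtain ⟨s, hs_def⟩ : ∃ s, s = Function.argminOn c (thinRadii σ f R ∩ Set.Ici t) h := ⟨_, rfl⟩
  rw [← hs_def] at hmem hmin
  obtain ⟨hs, hts⟩ := hmem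
  let A : Finset ℝ := insert t ((Finset.univ.filter fun v => f v ≤ s).image f)
  have hA : A.Nonempty := Finset.insert_nonempty _ _
  have hle : A.max' hA ≤ s := by
    refine Finset.max'_le _ _ _ fun y hy => ?_
    rcases Finset.mem_insert.mp hy with rfl | hy
    · exact hts
    · obtain ⟨v, hv, rfl⟩ := Finset.mem_image.mp hy
      exact (Finset.mem_filter.mp hv).2
  have htA : t ≤ A.max' hA := Finset.le_max' _ _ (Finset.mem_insert_self _ _)
  have heq : ∀ v, f v ≤ A.max' hA ↔ f v ≤ s := fun v =>
    ⟨fun h => h.trans hle, fun h => Finset.le_max' _ _ (Finset.mem_insert_of_mem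
      (Finset.mem_image_of_mem _ (by simpa using h)))⟩
  refine ⟨A.max' hA, ⟨ht.trans htA, hle.trans_lt hs.2.1, ?_⟩, htA, fun s' hs' => ?_⟩
  · simp only [heq]
    exact hs.2.2
  · rcases le_total s s' with hss | hss
    · exact hle.trans hss
    have hsub : (Finset.univ.filter fun v => f v ≤ s') ⊆ Finset.univ.filter fun v => f v ≤ s := by
      intro v hv
      simp only [Finset.mem_filter, Finset.mem_univ, true_and] at hv ⊢
      exact hv.trans hss
    have := Finset.eq_of_subset_of_card_le hsub (hmin s' hs')
    rw [Set.mem_Ici]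
    refine Finset.max'_le _ _ _ fun y hy => ?_
    rcases Finset.mem_insert.mp hy with rfl | hy
    · exact hs'.2
    · rw [← this] at hy
      obtain ⟨v, hv, rfl⟩ := Finset.mem_image.mp hy
      exact (Finset.mem_filter.mp hv).2

end Crossing

section Radii

variable {V : Type*} [Fintype V] {σ : Equiv.Perm V} {f : V → ℝ} {R : ℝ}

theorem volume_le_of_subset_Ico {s t : ℝ} (hst : s ≤ t) {A : Set ℝ} (hA : A ⊆ Set.Ico s t) :
    volume.real A ≤ t - s := by
  have := measureReal_mono hA (μ := volume) (by simp)
  rwa [Real.volume_real_Ico_of_le hst] at this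

theorem thinRadii_finite_inter (A : Set ℝ) (hA : A ⊆ thinRadii σ f R) : volume A ≠ ⊤ := by
  refine ne_top_of_le_ne_top ?_ (measure_mono (hA.trans (show thinRadii σ f R ⊆ Set.Ico 0 R from
    fun s hs => ⟨hs.1, hs.2.1⟩)))
  simp

open scoped Classical in
/-- Induction along an increasing sequence of radii, with a point of `V` between any two. -/
theorem radius_induction {P : ℝ → Prop} (f : V → ℝ)
    (h : ∀ s, (∀ s', s < s' → (∃ v, s < f v ∧ f v ≤ s') → P s') → P s) (s : ℝ) : P s := by
  induction hk : (Finset.univ.filter fun v => s < f v).card using Nat.strong_induction_on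
    generalizing s with
  | _ k ih =>
    refine h s fun s' hss hv => ih _ ?_ s' rfl
    rw [← hk]
    obtain ⟨v, hv1, hv2⟩ := hv
    refine Finset.card_lt_card ⟨fun w hw => ?_, fun hc => ?_⟩
    · simp only [Finset.mem_filter, Finset.mem_univ, true_and] at hw ⊢
      exact hss.trans hw
    · have := hc (Finset.mem_filter.mpr ⟨Finset.mem_univ v, hv1⟩)
      simp only [Finset.mem_filter, Finset.mem_univ, true_and] at this
      exact absurd hv2 (not_le.mpr this)

end Radii

section Excess

variable {V : Type*} [Fintype V] [MetricSpace V]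

open scoped Classical in
/-- The total excess of length over radial variation of the steps of `σ` in the open annulus with
radii `s` and `R`. -/
def annulusExcess (σ : Equiv.Perm V) (f : V → ℝ) (R s : ℝ) : ℝ :=
  ∑ v ∈ Finset.univ.filter (fun v => s < f v ∧ f v < R ∧ s < f (σ v) ∧ f (σ v) < R),
    (dist v (σ v) - |f v - f (σ v)|)

variable {σ : Equiv.Perm V} {f : V → ℝ} {R : ℝ}

theorem annulusExcess_nonneg (hf : ∀ u v, |f u - f v| ≤ dist u v) (s : ℝ) :
    0 ≤ annulusExcess σ f R s :=
  Finset.sum_nonneg fun _ _ => sub_nonneg.mpr (hf _ _)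

theorem annulusExcess_anti (hf : ∀ u v, |f u - f v| ≤ dist u v) {s s' : ℝ} (h : s ≤ s') :
    annulusExcess σ f R s' ≤ annulusExcess σ f R s := by
  classical
  refine Finset.sum_le_sum_of_subset_of_nonneg (fun v hv => ?_)
    fun v _ _ => sub_nonneg.mpr (hf _ _)
  simp only [Finset.mem_filter, Finset.mem_univ, true_and] at hv ⊢
  exact ⟨h.trans_lt hv.1, hv.2.1, h.trans_lt hv.2.2.1, hv.2.2.2⟩

theorem annulusExcess_ge (hf : ∀ u v, |f u - f v| ≤ dist u v) {s s' : ℝ} (hss : s ≤ s')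
    (hs' : s' < R) {v : V} (h1 : s < f v) (h2 : f v ≤ s') (h3 : s < f (σ v)) (h4 : f (σ v) ≤ s') :
    dist v (σ v) - |f v - f (σ v)| + annulusExcess σ f R s' ≤ annulusExcess σ f R s := by
  classical
  unfold annulusExcess
  rw [← Finset.sum_insert (f := fun v => dist v (σ v) - |f v - f (σ v)|)
    (by simp [not_lt.mpr h2])]
  refine Finset.sum_le_sum_of_subset_of_nonneg (fun w hw => ?_)
    fun v _ _ => sub_nonneg.mpr (hf _ _)
  simp only [Finset.mem_insert, Finset.mem_filter, Finset.mem_univ, true_and] at hw ⊢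
  rcases hw with rfl | hw
  · exact ⟨h1, h2.trans_lt hs', h3, h4.trans_lt hs'⟩
  · exact ⟨hss.trans_lt hw.1, hw.2.1, hss.trans_lt hw.2.2.1, hw.2.2.2⟩

/-- Two points on different lines in the annulus, one of them following the other on the tour. -/
theorem annulusExcess_jump (hσ : σ.IsCycleOn Set.univ) (hf : ∀ u v, |f u - f v| ≤ dist u v)
    {l : V → Fin 3} {s s' : ℝ} (hs : s ∈ thinRadii σ f R) (hs' : s' ∈ thinRadii σ f R) (hss : s ≤ s')
    (hl : ∀ i, ∃ v, l v = i ∧ s < f v ∧ f v ≤ s') :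
    ∃ u v, l u ≠ l v ∧ s < f u ∧ f u ≤ f v ∧ f v ≤ s' ∧
      dist u v - (f v - f u) + annulusExcess σ f R s' ≤ annulusExcess σ f R s := by
  obtain ⟨v, h1, h2, h3, h4, h5⟩ := exists_jump hσ hs.2.2 hs'.2.2 hl
  have := annulusExcess_ge hf hss hs'.2.1 h1 h2 h3 h4
  rcases le_total (f v) (f (σ v)) with h | h
  · refine ⟨v, σ v, h5, h1, h, h4, ?_⟩
    rw [abs_of_nonpos (by linarith)] at this
    linarith
  · refine ⟨σ v, v, h5.symm, h3, h, h2, ?_⟩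
    rw [abs_of_nonneg (by linarith)] at this
    rw [dist_comm]
    linarith

/-- One step of the greedy decomposition of the set of radii with a single exit. -/
theorem thinRadii_step (hσ : σ.IsCycleOn Set.univ) (hf : ∀ u v, |f u - f v| ≤ dist u v)
    {l : V → Fin 3} {s t : ℝ} (hs : s ∈ thinRadii σ f R) (hst : s < t)
    (hl : t < R → ∀ i, ∃ v, l v = i ∧ s < f v ∧ f v ≤ t) :
    volume.real (thinRadii σ f R ∩ Set.Ici s) ≤ t - s ∨
    ∃ s' ∈ thinRadii σ f R, t ≤ s' ∧
      volume.real (thinRadii σ f R ∩ Set.Ici s) ≤ t - s + volume.real (thinRadii σ f R ∩ Set.Ici s') ∧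
      ∃ u v, l u ≠ l v ∧ s < f u ∧ f u ≤ f v ∧ f v ≤ s' ∧
        dist u v - (f v - f u) + annulusExcess σ f R s' ≤ annulusExcess σ f R s := by
  rcases (thinRadii σ f R ∩ Set.Ici t).eq_empty_or_nonempty with h | h
  · left
    refine volume_le_of_subset_Ico hst.le fun x hx => ⟨hx.2, not_le.mp fun hx' => ?_⟩
    have : x ∈ thinRadii σ f R ∩ Set.Ici t := ⟨hx.1, hx'⟩
    rw [h] at this
    exact this
  · right
    obtain ⟨s', hs', hts', hmin⟩ := exists_min_thinRadii (hs.1.trans hst.le) h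
    refine ⟨s', hs', hts', ?_, ?_⟩
    · have hsub : thinRadii σ f R ∩ Set.Ici s ⊆
          (thinRadii σ f R ∩ Set.Ico s t) ∪ (thinRadii σ f R ∩ Set.Ici s') := by
        intro x hx
        rcases lt_or_ge x t with hxt | hxt
        · exact Or.inl ⟨hx.1, hx.2, hxt⟩
        · exact Or.inr ⟨hx.1, hmin ⟨hx.1, hxt⟩⟩
      refine (measureReal_mono hsub (thinRadii_finite_inter (σ := σ) (f := f) (R := R) _ (by
        simp))).trans ((measureReal_union_le _ _).trans ?_)
      exact add_le_add_left (volume_le_of_subset_Ico hst.le Set.inter_subset_right) _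
    · refine annulusExcess_jump hσ hf hs hs' (hst.le.trans hts') fun i => ?_
      obtain ⟨v, hv1, hv2, hv3⟩ := hl (hts'.trans_lt hs'.2.1) i
      exact ⟨v, hv1, hv2, hv3.trans hts'⟩

/-- The radii at the centre of a tripod with angles of 120 degrees with points at spacing `g`. -/
theorem centre_loss (hσ : σ.IsCycleOn Set.univ) (hf : ∀ u v, |f u - f v| ≤ dist u v)
    {l : V → Fin 3} {g : ℝ} (hg : 0 < g)
    (h1 : ∀ v, f v < R → ∃ j : ℕ, f v = j * g)
    (h2 : ∀ j : ℕ, 1 ≤ j → j * g < R → ∀ i, ∃ v, l v = i ∧ f v = j * g)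
    (h3 : ∀ u v, f u < R → f v < R → l u ≠ l v →
      f u ^ 2 + f v ^ 2 + f u * f v ≤ dist u v ^ 2) :
    2 * volume.real (thinRadii σ f R) ≤ 5 / 2 * g + annulusExcess σ f R 0 := by
  have hexc : ∀ u v, f u < R → f v < R → l u ≠ l v → 0 ≤ f u → f u ≤ f v →
      3 / 2 * f u ≤ dist u v - (f v - f u) := by
    intro u v hu hv hl h0 huv
    have := h3 u v hu hv hl
    have h' : (f v + f u / 2) ^ 2 ≤ dist u v ^ 2 := by nlinarith
    have := abs_le_of_sq_le_sq' h' dist_nonneg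
    linarith [this.2]
  have hnext : ∀ s, 0 ≤ s → ∃ t, s < t ∧ t ≤ s + g ∧
      (t < R → ∀ i, ∃ v, l v = i ∧ s < f v ∧ f v ≤ t) := by
    intro s hs
    have hfl := Nat.floor_le (div_nonneg hs hg.le)
    have hlt := Nat.lt_floor_add_one (s / g)
    rw [le_div_iff₀ hg] at hfl
    rw [div_lt_iff₀ hg] at hlt
    refine ⟨(⌊s / g⌋₊ + 1) * g, hlt, by linarith, fun ht i => ?_⟩
    obtain ⟨v, hv, hv'⟩ := h2 (⌊s / g⌋₊ + 1) (by omega) (by push_cast; exact ht) i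
    push_cast at hv'
    exact ⟨v, hv, hv' ▸ hlt, hv'.le⟩
  have hP : ∀ s, g ≤ s → s ∈ thinRadii σ f R →
      2 * volume.real (thinRadii σ f R ∩ Set.Ici s) ≤ 2 * g + annulusExcess σ f R s := by
    intro s
    induction s using radius_induction f with
    | _ s ih =>
      intro hgs hs
      obtain ⟨t, hst, hts, ht⟩ := hnext s hs.1
      rcases thinRadii_step hσ hf hs hst ht with h | ⟨s', hs', hts', hvol, u, v, hl, hu, huv, hv, hJ⟩
      · linarith [annulusExcess_nonneg (σ := σ) (R := R) hf s]
      · have := ih s' (by linarith) ⟨u, hu, huv.trans hv⟩ (by linarith) hs'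
        obtain ⟨j, hj⟩ := h1 u (by linarith [hs'.2.1])
        have hj2 : 2 ≤ j := by
          by_contra hc
          have : (j : ℝ) ≤ 1 := by exact_mod_cast (show j ≤ 1 by omega)
          nlinarith
        have hj2' : (2 : ℝ) ≤ j := by exact_mod_cast hj2
        have := hexc u v (by linarith [hs'.2.1]) (by linarith [hs'.2.1]) hl (by linarith [hs.1]) huv
        nlinarith
  rcases (thinRadii σ f R ∩ Set.Ici 0).eq_empty_or_nonempty with h | h
  · have h0 : thinRadii σ f R = ∅ := by
      rw [← h, eq_comm, Set.inter_eq_left]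
      exact fun s hs => hs.1
    rw [h0, measureReal_empty]
    linarith [annulusExcess_nonneg (σ := σ) (R := R) hf 0]
  · obtain ⟨s, hs, hs0, hmin⟩ := exists_min_thinRadii le_rfl h
    have hall : thinRadii σ f R = thinRadii σ f R ∩ Set.Ici s := by
      rw [eq_comm, Set.inter_eq_left]
      exact fun x hx => hmin ⟨hx, hx.1⟩
    have hanti := annulusExcess_anti (σ := σ) (R := R) hf hs0
    rw [hall]
    rcases le_or_gt g s with hgs | hgs
    · linarith [hP s hgs hs]
    · obtain ⟨t, hst, hts, ht⟩ := hnext s hs.1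
      rcases thinRadii_step hσ hf hs hst ht with h | ⟨s', hs', hts', hvol, u, v, hl, hu, huv, hv, hJ⟩
      · linarith [annulusExcess_nonneg (σ := σ) (R := R) hf s]
      · obtain ⟨j, hj⟩ := h1 u (by linarith [hs'.2.1])
        have hj2 : 1 ≤ j := by
          by_contra hc
          have : j = 0 := by omega
          rw [this] at hj
          simp at hj
          linarith
        have hj2' : (1 : ℝ) ≤ j := by exact_mod_cast hj2
        have := hexc u v (by linarith [hs'.2.1]) (by linarith [hs'.2.1]) hl (by linarith [hs.1]) huv
        have hgu : g ≤ f u := by nlinarith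
        have := hP s' (by linarith) hs'
        linarith

end Excess

section Radii

variable {V : Type*} [Fintype V] {σ : Equiv.Perm V} {f : V → ℝ} {R : ℝ}

theorem volume_thinRadii_split {s t : ℝ} (hs : 0 ≤ s)
    (h : thinRadii σ f R ⊆ Set.Ico 0 s ∪ thinRadii σ f R ∩ Set.Ici t) :
    volume.real (thinRadii σ f R) ≤ s + volume.real (thinRadii σ f R ∩ Set.Ici t) := by
  have h1 : volume (Set.Ico 0 s ∪ thinRadii σ f R ∩ Set.Ici t) ≠ ⊤ := by
    refine measure_union_ne_top (by simp) ?_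
    exact thinRadii_finite_inter (σ := σ) (f := f) (R := R) _ Set.inter_subset_left
  refine (measureReal_mono h h1).trans ((measureReal_union_le _ _).trans ?_)
  rw [Real.volume_real_Ico_of_le hs, sub_zero]

end Radii

section Corner

variable {V : Type*} [Fintype V] [MetricSpace V] {σ : Equiv.Perm V} {f : V → ℝ} {R : ℝ}

theorem sqrt_three_bounds : (1.732 : ℝ) < √3 ∧ √3 < 1.7321 := by
  constructor
  · exact Real.lt_sqrt_of_sq_lt (by norm_num)
  · rw [Real.sqrt_lt' (by norm_num)]
    norm_num

/-- The radii at a corner with three lines at mutual angles of at least 30 degrees.  Two lines have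
points at unit spacing; the points of the third start at radius `ρ`. -/
theorem corner_loss (hσ : σ.IsCycleOn Set.univ) (hf : ∀ u v, |f u - f v| ≤ dist u v)
    {l : V → Fin 3} {ρ : ℝ} (hR : 20 ≤ R) (hρ : 10 ≤ ρ) (hρ' : ρ ≤ 10 + √3 / 2)
    (h1 : ∀ v, f v < R → (∃ i : ℕ, f v = i) ∨ ρ ≤ f v)
    (h2 : ∀ i : ℕ, 1 ≤ i → (i : ℝ) < R → ∀ j, j ≠ 2 → ∃ v, l v = j ∧ f v = i)
    (h3 : ∀ s, 10 ≤ s → s + 1 < R → ∃ v, l v = 2 ∧ s < f v ∧ f v ≤ s + 1)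
    (h3' : ∃ v, l v = 2 ∧ f v = ρ)
    (h4 : ∀ u v, f u < R → f v < R → l u ≠ l v →
      f u ^ 2 + f v ^ 2 - √3 * (f u * f v) ≤ dist u v ^ 2) :
    2 * volume.real (thinRadii σ f R) ≤ (1 + √3 / 2) * ρ + 2 + annulusExcess σ f R 0 := by
  obtain ⟨hs1, hs2⟩ := sqrt_three_bounds
  have hs3 : √3 ^ 2 = 3 := Real.sq_sqrt (by norm_num)
  have hexc : ∀ u v, f u < R → f v < R → l u ≠ l v → 0 ≤ f u → f u ≤ f v →
      (1 - √3 / 2) * f u ≤ dist u v - (f v - f u) := by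
    intro u v hu hv hl h0 huv
    have := h4 u v hu hv hl
    have h' : (f v - √3 / 2 * f u) ^ 2 ≤ dist u v ^ 2 := by nlinarith [sq_nonneg (f u)]
    have := abs_le_of_sq_le_sq' h' dist_nonneg
    linarith [this.2]
  have hexc2 : ∀ u v, f u < R → f v < R → l u ≠ l v → 10 ≤ f u → f u ≤ f v →
      15 ≤ f u ∨ f v ≤ 27 → 2 ≤ dist u v - (f v - f u) := by
    intro u v hu hv hl h0 huv hor
    rcases hor with h | h
    · have := hexc u v hu hv hl (by linarith) huv
      nlinarith
    · have h5 := h4 u v hu hv hl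
      have h' : (f v - f u + 2) ^ 2 ≤ dist u v ^ 2 := by
        refine le_trans ?_ h5
        have h6 : 10 * f v ≤ f u * f v := mul_le_mul_of_nonneg_right h0 (by linarith)
        have h7 : 0.2679 * (10 * f v) ≤ (2 - √3) * (f u * f v) :=
          mul_le_mul (by linarith) h6 (by linarith) (by linarith)
        have h8 : f u ^ 2 + f v ^ 2 - √3 * (f u * f v) =
          (f v - f u) ^ 2 + (2 - √3) * (f u * f v) := by ring
        have h9 : (f v - f u + 2) ^ 2 = (f v - f u) ^ 2 + 4 * (f v - f u) + 4 := by ring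
        rw [h8, h9]
        linarith
      have := abs_le_of_sq_le_sq' h' dist_nonneg
      linarith [this.2]
  have hJ0 : ∀ s, 0 ≤ annulusExcess σ f R s := annulusExcess_nonneg hf
  have hJ : ∀ {s s'}, s ≤ s' → annulusExcess σ f R s' ≤ annulusExcess σ f R s :=
    fun h => annulusExcess_anti hf h
  have hP : ∀ s, 10 ≤ s → s ∈ thinRadii σ f R → 2 * volume.real (thinRadii σ f R ∩ Set.Ici s) ≤
      2 + annulusExcess σ f R s + max 0 (2 - (1 - √3 / 2) * s) := by
    intro s
    induction s using radius_induction f with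
    | _ s ih =>
      intro h10 hs
      rcases thinRadii_step hσ hf (l := l) hs (lt_add_one s) (fun ht i => by
        by_cases hi : i = 2
        · subst hi
          exact h3 s h10 ht
        · have hfl := Nat.floor_le hs.1
          have hlt := Nat.lt_floor_add_one s
          obtain ⟨v, hv, hv'⟩ := h2 (⌊s⌋₊ + 1) (by omega) (by push_cast; linarith) i hi
          push_cast at hv'
          exact ⟨v, hv, by linarith, by linarith⟩) with
        h | ⟨s', hs', hts', hvol, u, v, hl, hu, huv, hv, hJs⟩
      · linarith [hJ0 s, le_max_left 0 (2 - (1 - √3 / 2) * s)]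
      · have hi := ih s' (by linarith) ⟨u, hu, huv.trans hv⟩ (by linarith) hs'
        have huR : f u < R := by linarith [hs'.2.1]
        have hvR : f v < R := by linarith [hs'.2.1]
        by_cases hor : 15 ≤ f u ∨ f v ≤ 27
        · have := hexc2 u v huR hvR hl (by linarith) huv hor
          have hm : max 0 (2 - (1 - √3 / 2) * s') ≤ max 0 (2 - (1 - √3 / 2) * s) :=
            max_le_max le_rfl (by nlinarith)
          linarith
        · push Not at hor
          have := hexc u v huR hvR hl (by linarith) huv
          have hm : max 0 (2 - (1 - √3 / 2) * s') = 0 := max_eq_left (by nlinarith)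
          have := le_max_right 0 (2 - (1 - √3 / 2) * s)
          nlinarith
  have hbase : (2 - (1 - √3 / 2)) * 10 ≤ (1 + √3 / 2) * ρ := by nlinarith
  have hpos : 0 ≤ 2 - (1 - √3 / 2) * ρ := by nlinarith
  have hconst : ∀ (k : ℕ) (a s : ℝ), (k : ℝ) ≤ s → s < a → a ≤ ρ → a ≤ k + 1 →
      s ∈ thinRadii σ f R → (k : ℝ) ∈ thinRadii σ f R := by
    intro k a s hks hsa ha hak hs
    refine ⟨by positivity, hks.trans_lt hs.2.1, ?_⟩
    rw [← hs.2.2]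
    congr 1
    ext v
    refine ⟨fun h => h.trans hks, fun h => ?_⟩
    rcases h1 v (h.trans_lt hs.2.1) with ⟨i, hi⟩ | h'
    · have : i < k + 1 := by
        have : (i : ℝ) < k + 1 := by linarith
        exact_mod_cast this
      rw [hi]
      exact_mod_cast (show i ≤ k by omega)
    · linarith
  have hjump : ∀ (k : ℕ) (s : ℝ), (k : ℝ) ∈ thinRadii σ f R → s ∈ thinRadii σ f R → (k : ℝ) + 1 ≤ s →
      (∃ v, l v = 2 ∧ k < f v ∧ f v ≤ s) →
      ∃ u v, l u ≠ l v ∧ k < f u ∧ f u ≤ f v ∧ f v ≤ s ∧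
      dist u v - (f v - f u) + annulusExcess σ f R s ≤ annulusExcess σ f R k := by
    intro k s hk hs hks he
    refine annulusExcess_jump hσ hf hk hs (by linarith) fun i => ?_
    by_cases hi : i = 2
    · subst hi
      exact he
    · obtain ⟨v, hv, hv'⟩ := h2 (k + 1) (by omega) (by push_cast; linarith [hs.2.1]) i hi
      push_cast at hv'
      exact ⟨v, hv, by linarith, by linarith⟩
  by_cases h9 : (9 : ℝ) ∈ thinRadii σ f R
  · rcases (thinRadii σ f R ∩ Set.Ici ρ).eq_empty_or_nonempty with h | h
    · have : volume.real (thinRadii σ f R) ≤ ρ - 0 := by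
        refine volume_le_of_subset_Ico (by linarith) fun x hx => ⟨hx.1, not_le.mp fun hx' => ?_⟩
        have : x ∈ thinRadii σ f R ∩ Set.Ici ρ := ⟨hx, hx'⟩
        rw [h] at this
        exact this
      nlinarith [hJ0 0]
    · obtain ⟨s, hs, hρs, hmin⟩ := exists_min_thinRadii (by linarith) h
      have hvol := volume_thinRadii_split (σ := σ) (f := f) (R := R) (s := ρ) (t := s) (by linarith)
        fun x hx => by
          rcases lt_or_ge x ρ with h | h
          · exact Or.inl ⟨hx.1, h⟩
          · exact Or.inr ⟨hx, hmin ⟨hx, h⟩⟩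
      have hPs := hP s (by linarith) hs
      have h9' : ((9 : ℕ) : ℝ) ∈ thinRadii σ f R := by exact_mod_cast h9
      have hint : ∀ u, f u < R → 9 < f u → 10 ≤ f u := by
        intro u hu h9u
        rcases h1 u hu with ⟨i, hi⟩ | h'
        · rw [hi] at h9u ⊢
          have : 9 < i := by exact_mod_cast h9u
          exact_mod_cast this
        · linarith
      obtain ⟨u, v, hl, hu, huv, hv, hJs⟩ := hjump 9 s h9' hs (by norm_num; linarith) (by
        obtain ⟨v, hv, hv'⟩ := h3'
        exact ⟨v, hv, by rw [hv']; norm_num; linarith, by linarith⟩)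
      push_cast at hu hJs
      have huR : f u < R := by linarith [hs.2.1]
      have hvR : f v < R := by linarith [hs.2.1]
      have hu10 := hint u huR hu
      have hJ9 := hJ (show (0 : ℝ) ≤ 9 by norm_num)
      rcases le_or_gt s 27 with h27 | h27
      · have := hexc2 u v huR hvR hl hu10 huv (Or.inr (by linarith))
        have hm : max 0 (2 - (1 - √3 / 2) * s) ≤ 2 - (1 - √3 / 2) * ρ :=
          max_le hpos (by nlinarith)
        linarith
      · have hm : max 0 (2 - (1 - √3 / 2) * s) = 0 := max_eq_left (by nlinarith)
        by_cases h10 : (10 : ℝ) ∈ thinRadii σ f R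
        · have h10' : ((10 : ℕ) : ℝ) ∈ thinRadii σ f R := by exact_mod_cast h10
          obtain ⟨u, v, hl, hu, huv, hv, hJs⟩ := hjump 10 s h10' hs (by norm_num; linarith) (by
            obtain ⟨v, hv, hv', hv''⟩ := h3 10 le_rfl (by linarith)
            exact ⟨v, hv, by exact_mod_cast hv', by linarith⟩)
          push_cast at hu hJs
          have huR : f u < R := by linarith [hs.2.1]
          have hvR : f v < R := by linarith [hs.2.1]
          have huρ : ρ ≤ f u := by
            rcases h1 u huR with ⟨i, hi⟩ | h'
            · rw [hi] at hu ⊢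
              have : 10 < i := by exact_mod_cast hu
              have : (11 : ℝ) ≤ i := by exact_mod_cast this
              linarith
            · exact h'
          have := hexc u v huR hvR hl (by linarith) huv
          have hJ10 := hJ (show (0 : ℝ) ≤ 10 by norm_num)
          nlinarith
        · have hvol' := volume_thinRadii_split (σ := σ) (f := f) (R := R) (s := 10) (t := s)
            (by norm_num) fun x hx => by
              rcases lt_or_ge x 10 with h | h
              · exact Or.inl ⟨hx.1, h⟩
              · refine Or.inr ⟨hx, hmin ⟨hx, Set.mem_Ici.mpr (not_lt.mp fun hc => h10 ?_)⟩⟩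
                exact_mod_cast hconst 10 ρ x (by exact_mod_cast h) hc le_rfl
                  (by norm_num; linarith) hx
          have := hexc u v huR hvR hl (by linarith) huv
          nlinarith
  · have h9sub : ∀ x ∈ thinRadii σ f R, x < 9 ∨ 10 ≤ x := by
      intro x hx
      by_contra! hc
      exact h9 (by exact_mod_cast hconst 9 10 x (by exact_mod_cast hc.1) hc.2 hρ (by norm_num) hx)
    rcases (thinRadii σ f R ∩ Set.Ici 10).eq_empty_or_nonempty with h | h
    · have : volume.real (thinRadii σ f R) ≤ 9 - 0 := by
        refine volume_le_of_subset_Ico (by norm_num) fun x hx => ⟨hx.1, ?_⟩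
        refine (h9sub x hx).resolve_right fun hx' => ?_
        have : x ∈ thinRadii σ f R ∩ Set.Ici 10 := ⟨hx, hx'⟩
        rw [h] at this
        exact this
      nlinarith [hJ0 0]
    · obtain ⟨s, hs, hs10, hmin⟩ := exists_min_thinRadii (by norm_num) h
      have hvol := volume_thinRadii_split (σ := σ) (f := f) (R := R) (s := 9) (t := s) (by norm_num)
        fun x hx => (h9sub x hx).imp (fun h => ⟨hx.1, h⟩) fun h => ⟨hx, hmin ⟨hx, h⟩⟩
      have hPs := hP s hs10 hs
      have hm : max 0 (2 - (1 - √3 / 2) * s) ≤ 2 - (1 - √3 / 2) * 10 :=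
        max_le (by nlinarith) (by nlinarith)
      have := hJ (hs.1)
      linarith

end Corner

section Moats

open scoped Classical in
/-- The part of the length of a step from `u` to `v` that is charged to the disc `f < R`. -/
def moatLength {V : Type*} [MetricSpace V] (f : V → ℝ) (R : ℝ) (u v : V) : ℝ :=
  if f u < R ∧ f v < R then dist u v else |min (f u) R - min (f v) R|

theorem sum_moatLength_ge {V : Type*} [Fintype V] [MetricSpace V] {σ : Equiv.Perm V}
    (hσ : σ.IsCycleOn Set.univ) {f : V → ℝ} {R L : ℝ}
    (hf : ∀ u v, |f u - f v| ≤ dist u v) (hR : 0 < R) (h0 : ∀ v, 0 ≤ f v)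
    (hz : ∃ v, f v = 0) (hfar : ∃ v, R ≤ f v)
    (hL : 2 * volume.real (thinRadii σ f R) ≤ L + annulusExcess σ f R 0) :
    4 * R - L ≤ ∑ v, moatLength f R v (σ v) := by
  classical
  have h1 := sum_variation_ge hσ hR h0 hz hfar
  have h2 : annulusExcess σ f R 0 + ∑ v, |min (f v) R - min (f (σ v)) R| ≤
      ∑ v, moatLength f R v (σ v) := by
    rw [annulusExcess, Finset.sum_filter, ← Finset.sum_add_distrib]
    refine Finset.sum_le_sum fun v _ => ?_
    unfold moatLength
    by_cases h : f v < R ∧ f (σ v) < R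
    · rw [if_pos h, min_eq_left h.1.le, min_eq_left h.2.le]
      split_ifs
      · linarith
      · linarith [hf v (σ v)]
    · rw [if_neg h, if_neg (fun h' => h ⟨h'.2.1, h'.2.2.2⟩), zero_add]
  linarith

/-- The parts charged to disjoint discs add up to at most the length of the step. -/
theorem sum_moatLength_le {X : Type*} [MetricSpace X] {ι : Type*} [Fintype ι] (c : ι → X)
    (R : ι → ℝ) (hc : ∀ i j, i ≠ j → R i + R j ≤ dist (c i) (c j)) (u v : X) :
    ∑ i, moatLength (fun p => dist (c i) p) (R i) u v ≤ dist u v := by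
  classical
  let a : ι → X → ℝ := fun i p => R i - min (dist (c i) p) (R i)
  have ha0 : ∀ i p, 0 ≤ a i p := fun i p => sub_nonneg.mpr (min_le_right _ _)
  have hdisj : ∀ i j p, dist (c i) p < R i → dist (c j) p < R j → i = j := by
    intro i j p hi hj
    by_contra hij
    have := hc i j hij
    have := dist_triangle_right (c i) (c j) p
    linarith
  have hone : ∀ i p, dist (c i) p < R i → ∑ k, a k p = R i - dist (c i) p := by
    intro i p hi
    rw [Finset.sum_eq_single i]
    · simp only [a, min_eq_left hi.le]
    · intro j _ hj
      simp only [a, sub_eq_zero]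
      rw [min_eq_right]
      exact not_lt.mp fun h => hj (hdisj _ _ _ h hi)
    · simp
  have hnone : ∀ p, (∀ i, R i ≤ dist (c i) p) → ∑ k, a k p = 0 := by
    intro p hp
    refine Finset.sum_eq_zero fun j _ => ?_
    simp only [a, sub_eq_zero]
    rw [min_eq_right (hp j)]
  by_cases hboth : ∃ i, dist (c i) u < R i ∧ dist (c i) v < R i
  · obtain ⟨i, hi, hi'⟩ := hboth
    rw [Finset.sum_eq_single i]
    · simp [moatLength, hi, hi']
    · intro j _ hj
      have h1 : ¬ dist (c j) u < R j := fun h => hj (hdisj _ _ _ h hi)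
      have h2 : ¬ dist (c j) v < R j := fun h => hj (hdisj _ _ _ h hi')
      simp [moatLength, h1, min_eq_right (not_lt.mp h1), min_eq_right (not_lt.mp h2)]
    · simp
  · push Not at hboth
    have hle : ∑ i, moatLength (fun p => dist (c i) p) (R i) u v ≤
        ∑ i, a i u + ∑ i, a i v := by
      rw [← Finset.sum_add_distrib]
      refine Finset.sum_le_sum fun i _ => ?_
      rw [moatLength, if_neg (fun h => absurd h.2 (not_lt.mpr (hboth i h.1)))]
      have h1 := ha0 i u
      have h2 := ha0 i v
      simp only [a] at h1 h2 ⊢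
      rw [abs_le]
      constructor <;> linarith
    refine hle.trans ?_
    by_cases hu : ∃ i, dist (c i) u < R i
    · obtain ⟨i, hi⟩ := hu
      by_cases hv : ∃ j, dist (c j) v < R j
      · obtain ⟨j, hj⟩ := hv
        have hij : i ≠ j := by
          rintro rfl
          exact absurd hj (not_lt.mpr (hboth i hi))
        rw [hone i u hi, hone j v hj]
        have := hc i j hij
        have h1 := dist_triangle (c i) u (c j)
        have h2 := dist_triangle u v (c j)
        rw [dist_comm v] at h2
        linarith
      · push Not at hv
        rw [hone i u hi, hnone v hv]
        have := hboth i hi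
        linarith [dist_triangle (c i) u v]
    · push Not at hu
      rw [hnone u hu]
      by_cases hv : ∃ j, dist (c j) v < R j
      · obtain ⟨j, hj⟩ := hv
        rw [hone j v hj]
        have := hu j
        linarith [dist_triangle (c j) v u, dist_comm u v]
      · push Not at hv
        rw [hnone v hv]
        linarith [dist_nonneg (x := u) (y := v)]

end Moats

/-! ### Closed walks -/

section Walks

variable {X : Type*} [MetricSpace X]

/-- The length of the walk that starts at `a` and visits the points of a list in turn. -/
def walkLength : X → List X → ℝ
  | _, [] => 0
  | a, b :: t => dist a b + walkLength b t

theorem walkLength_le_dist_add (a b z : X) (t : List X) :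
    walkLength a (t ++ [z]) ≤ dist a b + walkLength b (t ++ [z]) := by
  cases t with
  | nil => simpa [walkLength] using dist_triangle a b z
  | cons c t =>
    simp only [List.cons_append, walkLength]
    linarith [dist_triangle a b c]

theorem walkLength_sublist {t' t : List X} (h : t'.Sublist t) (a z : X) :
    walkLength a (t' ++ [z]) ≤ walkLength a (t ++ [z]) := by
  induction h generalizing a with
  | slnil => exact le_rfl
  | cons b _ ih =>
    refine (walkLength_le_dist_add a b z _).trans ?_
    simp only [List.cons_append, walkLength]
    linarith [ih b]
  | cons_cons b _ ih =>
    simp only [List.cons_append, walkLength]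
    linarith [ih b]

theorem walkLength_eq_sum (a : X) (t : List X) :
    walkLength a t = ∑ i : Fin t.length, dist ((a :: t)[(i : ℕ)]'(by simp))
      (t[(i : ℕ)]) := by
  induction t generalizing a with
  | nil => simp [walkLength]
  | cons b t ih =>
    rw [walkLength, ih b]
    exact (Fin.sum_univ_succ (n := t.length) (fun i => dist ((a :: b :: t)[(i : ℕ)]'(by
      have := i.2; simp)) ((b :: t)[(i : ℕ)]'(by have := i.2; simp; omega)))).symm

/-- A closed walk that visits all points is at least as long as an optimum tour. -/
theorem optTour_le_walkLength {V : Type*} [MetricSpace V] [Fintype V] (z : V) (t : List V)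
    (h : ∀ v, v = z ∨ v ∈ t) : optTour V ≤ walkLength z (t ++ [z]) := by
  classical
  let t' := (t.filter (· ≠ z)).dedup
  have hsub : t'.Sublist t := (List.dedup_sublist _).trans List.filter_sublist
  refine le_trans ((isLeast_optTour V).2 ?_) (walkLength_sublist hsub z z)
  have hnd : (z :: t').Nodup := by
    refine List.nodup_cons.mpr ⟨?_, List.nodup_dedup _⟩
    simp [t']
  have hmem : ∀ v, v ∈ z :: t' := by
    intro v
    by_cases hv : v = z
    · simp [hv]
    · simp only [t', List.mem_cons, List.mem_dedup, List.mem_filter]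
      exact Or.inr ⟨(h v).resolve_left hv, by simpa using hv⟩
  refine ⟨(z :: t').formPerm, ?_, ?_⟩
  · have := hnd.isCycleOn_formPerm
    rwa [show {a | a ∈ z :: t'} = Set.univ from Set.eq_univ_of_forall hmem] at this
  · have hlen : (t' ++ [z]).length = (z :: t').length := by simp
    rw [walkLength_eq_sum]
    let e : Fin (t' ++ [z]).length ≃ V := Equiv.ofBijective (fun i => (z :: t')[(i : ℕ)]'(by
      have := i.2; omega)) ⟨fun i j hij => by
        have := (List.Nodup.getElem_inj_iff hnd).mp hij
        exact Fin.ext this, fun v => by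
        obtain ⟨i, hi, hv⟩ := List.mem_iff_getElem.mp (hmem v)
        exact ⟨⟨i, by omega⟩, hv⟩⟩
    rw [← Equiv.sum_comp e]
    refine Finset.sum_congr rfl fun i _ => ?_
    have hi := i.2
    have h1 : e i = (z :: t')[(i : ℕ)]'(by omega) := rfl
    rw [h1, List.formPerm_apply_getElem _ hnd]
    congr 1
    · simp only [← List.cons_append]
      rw [List.getElem_append_left]
    · simp only [List.length_append, List.length_singleton] at hi
      simp only [List.length_cons]
      rcases Nat.lt_or_ge (i : ℕ) t'.length with hlt | hge
      · rw [List.getElem_append_left hlt]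
        simp [Nat.mod_eq_of_lt (show (i : ℕ) + 1 < t'.length + 1 by omega)]
      · have : (i : ℕ) = t'.length := by omega
        simp [this]

theorem walkLength_map_range (a : X) (p : ℕ → X) (d : ℝ) (N : ℕ)
    (hd : ∀ i < N, dist (p i) (p (i + 1)) = d) (t : List X) : walkLength a ((List.range (N + 1)).map p ++ t) =
      dist a (p 0) + N * d + walkLength (p N) t := by
  induction N generalizing t with
  | zero => simp [walkLength]
  | succ N ih =>
    rw [List.range_succ, List.map_append, List.append_assoc, ih fun i hi => hd i (by omega)]
    simp only [List.map_cons, List.map_nil, List.cons_append, List.nil_append, walkLength,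
      hd N (by omega)]
    push_cast
    ring

end Walks

end

/-! ### Bounds for the subtour LP -/

section LP

variable {V : Type*}

open scoped Classical in
theorem mem_edgesWithin {X : Finset V} {a b : V} :
    s(a, b) ∈ edgesWithin X ↔ a ∈ X ∧ b ∈ X ∧ a ≠ b := by
  simp [edgesWithin, and_assoc]

variable {E : Type*} [Fintype E]

open scoped Classical in
/-- The edge weights of a weighted multigraph. -/
def edgeWeight (a b : E → V) (w : E → ℝ) (e : Sym2 V) : ℝ := ∑ i, if s(a i, b i) = e then w i else 0

open scoped Classical in
theorem sum_edgeWeight (a b : E → V) (w : E → ℝ) (F : Finset (Sym2 V)) (g : Sym2 V → ℝ) :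
    ∑ e ∈ F, g e * edgeWeight a b w e =
      ∑ i, if s(a i, b i) ∈ F then g s(a i, b i) * w i else 0 := by
  simp only [edgeWeight, Finset.mul_sum]
  rw [Finset.sum_comm]
  refine Finset.sum_congr rfl fun i _ => ?_
  simp

variable [Fintype V]

open scoped Classical in
theorem mem_edgesAt {v a b : V} : s(a, b) ∈ edgesAt v ↔ a ≠ b ∧ (v = a ∨ v = b) := by
  simp [edgesAt, mem_edgesWithin]

variable [MetricSpace V]

theorem sum_le_lpValue {r : V → ℝ} (hr : ∀ v w, v ≠ w → r v ≤ dist v w) {x : Sym2 V → ℝ}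
    (hx : IsSubtourFeasible x) : ∑ v, r v ≤ lpValue x := by
  classical
  have h1 : ∑ v, ∑ e ∈ edgesAt v, edgeLength e * x e = 2 * lpValue x := by
    simp only [edgesAt, Finset.sum_filter]
    rw [Finset.sum_comm, lpValue, Finset.mul_sum]
    refine Finset.sum_congr rfl fun e he => ?_
    rw [← Finset.sum_filter, Finset.sum_const]
    have hd : ¬ e.IsDiag := (Finset.mem_filter.mp he).2
    have : (Finset.univ.filter fun v => v ∈ e) = e.toFinset := by
      ext v
      simp
    rw [this, Sym2.card_toFinset_of_not_isDiag e hd]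
    simp
  have h2 : ∀ v, 2 * r v ≤ ∑ e ∈ edgesAt v, edgeLength e * x e := by
    intro v
    rw [← hx.degree v, Finset.sum_mul]
    refine Finset.sum_le_sum fun e he => ?_
    have hx0 := hx.nonneg e (Finset.mem_filter.mp he).1
    rw [mul_comm]
    refine mul_le_mul_of_nonneg_right ?_ hx0
    induction e using Sym2.ind with
    | _ a b =>
      obtain ⟨hab, rfl | rfl⟩ := mem_edgesAt.mp he
      · exact hr _ _ hab
      · change _ ≤ dist a v
        rw [dist_comm]
        exact hr _ _ hab.symm
  have h3 := Finset.sum_le_sum fun v (_ : v ∈ Finset.univ) => h2 v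
  rw [← Finset.mul_sum, h1] at h3
  linarith

theorem sum_le_optSubtourLP (hV : 3 ≤ Fintype.card V) {r : V → ℝ}
    (hr : ∀ v w, v ≠ w → r v ≤ dist v w) : ∑ v, r v ≤ optSubtourLP V := by
  obtain ⟨x, hx, h⟩ := (isLeast_optSubtourLP V hV).1
  rw [h]
  exact sum_le_lpValue hr hx

/-- A weighted multigraph in which all vertices have degree two and all cuts have weight at least
two is a feasible solution of the subtour LP. -/
theorem optSubtourLP_le (hV : 3 ≤ Fintype.card V) [DecidableEq V] {a b : E → V} {w : E → ℝ}
    (hab : ∀ i, a i ≠ b i) (hw : ∀ i, 0 ≤ w i)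
    (hdeg : ∀ v, ∑ i, w i * ((if a i = v then 1 else 0) + (if b i = v then 1 else 0)) = 2)
    (hcut : ∀ χ : V → Bool, (∃ v, χ v = true) → (∃ v, χ v = false) →
      2 ≤ ∑ i, w i * ((χ (a i)) ^^ (χ (b i))).toNat) :
    optSubtourLP V ≤ ∑ i, w i * dist (a i) (b i) := by
  classical
  have hsum : ∀ F : Finset (Sym2 V), ∑ e ∈ F, edgeWeight a b w e =
      ∑ i, if s(a i, b i) ∈ F then w i else 0 := by
    intro F
    simpa using sum_edgeWeight a b w F (fun _ => 1)
  have hnn : ∀ e, 0 ≤ edgeWeight a b w e := fun e =>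
    Finset.sum_nonneg fun i _ => by split_ifs <;> simp [hw]
  have hsub : ∀ X : Finset V, X.Nonempty → X ≠ Finset.univ →
      ∑ e ∈ edgesWithin X, edgeWeight a b w e ≤ (X.card : ℝ) - 1 := by
    intro X hX hXu
    have h1 := hcut (fun v => decide (v ∈ X)) (by
      obtain ⟨v, hv⟩ := hX
      exact ⟨v, by simpa⟩) (by
      by_contra! hc
      exact hXu (Finset.eq_univ_iff_forall.mpr fun v => by simpa using hc v))
    have h2 : ∑ v ∈ X, ∑ i, w i * ((if a i = v then (1 : ℝ) else 0) + (if b i = v then 1 else 0))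
        = 2 * X.card := by
      rw [Finset.sum_congr rfl fun v _ => hdeg v]
      simp [mul_comm]
    rw [Finset.sum_comm] at h2
    have h3 : ∀ i, ∑ v ∈ X, w i * ((if a i = v then (1 : ℝ) else 0) + (if b i = v then 1 else 0)) =
        2 * (if s(a i, b i) ∈ edgesWithin X then w i else 0) +
        w i * (decide (a i ∈ X) ^^ decide (b i ∈ X)).toNat := by
      intro i
      rw [← Finset.mul_sum, Finset.sum_add_distrib, Finset.sum_ite_eq, Finset.sum_ite_eq]
      by_cases ha : a i ∈ X <;> by_cases hb : b i ∈ X <;>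
        simp [mem_edgesWithin, ha, hb, hab i]
      ring
    rw [Finset.sum_congr rfl fun i _ => h3 i, Finset.sum_add_distrib, ← Finset.mul_sum] at h2
    rw [hsum]
    linarith
  have hfeas : IsSubtourFeasible (edgeWeight a b w) := by
    refine ⟨fun e _ => hnn e, fun e he => ?_, fun v => ?_, hsub⟩
    · induction e using Sym2.ind with
      | _ p q =>
        have hpq := (mem_edgesWithin.mp he).2.2
        have h1 := hsub {p, q} (by simp) (fun h => by
          have := congrArg Finset.card h
          rw [Finset.card_pair hpq, Finset.card_univ] at this
          omega)
        rw [Finset.card_pair hpq] at h1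
        have h2 := Finset.single_le_sum (f := edgeWeight a b w) (fun e _ => hnn e)
          (mem_edgesWithin.mpr ⟨by simp, by simp, hpq⟩ : s(p, q) ∈ edgesWithin {p, q})
        norm_num at h1
        linarith
    · rw [hsum, ← hdeg v]
      refine Finset.sum_congr rfl fun i _ => ?_
      have := hab i
      simp only [mem_edgesAt]
      by_cases h1 : a i = v
      · subst h1
        simp [this, this.symm]
      · by_cases h2 : b i = v
        · subst h2
          simp [this]
        · simp [h1, h2, Ne.symm h1, Ne.symm h2]
  refine ((isLeast_optSubtourLP V hV).2 ⟨_, hfeas, rfl⟩).trans (le_of_eq ?_)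
  rw [lpValue, sum_edgeWeight]
  refine Finset.sum_congr rfl fun i _ => ?_
  rw [if_pos (mem_edgesWithin.mpr ⟨by simp, by simp, hab i⟩), mul_comm]
  rfl

end LP

/-! ### Six paths joined by four triangles -/

section SixPaths

theorem exists_change {P : ℕ → Bool} {i j : ℕ} (hij : i ≤ j) (h : P i ≠ P j) :
    ∃ t, i ≤ t ∧ t < j ∧ P t ≠ P (t + 1) := by
  by_contra! hc
  have : ∀ k, i + k ≤ j → P (i + k) = P i := by
    intro k
    induction k with
    | zero => simp
    | succ k ih =>
      intro hk
      rw [← add_assoc, ← hc (i + k) (by omega) (by omega)]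
      exact ih (by omega)
  have := this (j - i) (by omega)
  rw [Nat.add_sub_cancel' hij] at this
  exact h this.symm

theorem xor_toNat {b c : Bool} (h : b ≠ c) : (b ^^ c).toNat = 1 := by
  revert b c
  decide

theorem sum_change_ge_one {P : ℕ → Bool} {L : ℕ} :
    ((P 0 ^^ P L).toNat : ℝ) ≤ ∑ i : Fin L, ((P i ^^ P (i + 1)).toNat : ℝ) := by
  by_cases h : P 0 = P L
  · rw [h, Bool.xor_self, Bool.toNat_false, Nat.cast_zero]
    exact Finset.sum_nonneg fun i _ => Nat.cast_nonneg _
  · obtain ⟨t, -, ht, hne⟩ := exists_change (Nat.zero_le L) h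
    refine le_trans ?_ (Finset.single_le_sum (fun i _ => Nat.cast_nonneg _)
      (Finset.mem_univ ⟨t, ht⟩))
    simp [xor_toNat hne, xor_toNat h]

theorem sum_change_ge_two {P : ℕ → Bool} {L i : ℕ} (hi : i ≤ L) (h0 : P 0 ≠ P i)
    (h1 : P i ≠ P L) : 2 ≤ ∑ i : Fin L, ((P i ^^ P (i + 1)).toNat : ℝ) := by
  obtain ⟨t, -, ht, hne⟩ := exists_change (Nat.zero_le i) h0
  obtain ⟨t', ht', ht'', hne'⟩ := exists_change hi h1
  refine le_trans ?_ (Finset.sum_le_sum_of_subset_of_nonneg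
    (Finset.subset_univ {(⟨t, by omega⟩ : Fin L), ⟨t', ht''⟩}) fun i _ _ => Nat.cast_nonneg _)
  rw [Finset.sum_pair (by simp; omega)]
  simp [xor_toNat hne, xor_toNat hne']
  norm_num

/-- The end points of the paths that form the four triangles.  Path `0` runs from the corner `A`
to `B`, path `1` from `B` to `C`, path `2` from `C` to `A`, and the paths `3`, `4`, `5` from the
corners to the centre. -/
def triangleEnd : Fin 4 → Fin 3 → Fin 6 × Bool :=
  ![![(0, false), (2, true), (3, false)], ![(1, false), (0, true), (4, false)],
    ![(2, false), (1, true), (5, false)], ![(3, true), (4, true), (5, true)]]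

theorem triangleEnd_bijective :
    Function.Bijective (fun p : Fin 4 × Fin 3 => triangleEnd p.1 p.2) := by
  constructor
  · decide
  · decide

set_option synthInstance.maxSize 20000 in
set_option maxRecDepth 10000 in
theorem cut_ends (c c' a a' b b' e e' f f' g g' : Bool) :
    (c = c' ∧ c = a ∧ c = a' ∧ c = b ∧ c = b' ∧ c = e ∧ c = e' ∧ c = f ∧ c = f' ∧ c = g ∧ c = g') ∨
    4 ≤ 2 * ((c ^^ c').toNat + (a ^^ a').toNat + (b ^^ b').toNat + (e ^^ e').toNat +
      (f ^^ f').toNat + (g ^^ g').toNat) +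
      (((c ^^ b').toNat + (b' ^^ e).toNat + (e ^^ c).toNat) +
      ((a ^^ c').toNat + (c' ^^ f).toNat + (f ^^ a).toNat) +
      ((b ^^ a').toNat + (a' ^^ g).toNat + (g ^^ b).toNat) +
      ((e' ^^ f').toNat + (f' ^^ g').toNat + (g' ^^ e').toNat)) := by
  revert c c' a a' b b' e e' f f' g g'
  decide +kernel

variable {V : Type*} [Fintype V] [MetricSpace V]

theorem optSubtourLP_le_sixPaths (hV : 3 ≤ Fintype.card V) (L : Fin 6 → ℕ) (hL : ∀ k, 1 ≤ L k)
    (p : Fin 6 → ℕ → V) (hsurj : ∀ v, ∃ k i, i ≤ L k ∧ p k i = v)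
    (hinj : ∀ k i k' i', i ≤ L k → i' ≤ L k' → p k i = p k' i' → k = k' ∧ i = i') :
    optSubtourLP V ≤ ∑ k, ∑ i : Fin (L k), dist (p k i) (p k (i + 1)) +
      1 / 2 * ∑ q, ∑ r, dist
        (p (triangleEnd q r).1 (if (triangleEnd q r).2 then L (triangleEnd q r).1 else 0))
        (p (triangleEnd q (r + 1)).1
          (if (triangleEnd q (r + 1)).2 then L (triangleEnd q (r + 1)).1 else 0)) := by
  classical
  let t : Fin 6 × Bool → V := fun z => p z.1 (if z.2 then L z.1 else 0)
  have ht : Function.Injective t := by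
    rintro ⟨k, s⟩ ⟨k', s'⟩ h
    obtain ⟨hk, h2⟩ := hinj k _ k' _ (by dsimp only; split_ifs <;> omega)
      (by dsimp only; split_ifs <;> omega) h
    dsimp only at hk h2
    subst hk
    have := hL k
    congr 1
    cases s <;> cases s' <;> simp at h2 ⊢ <;> omega
  let a : (Σ k, Fin (L k)) ⊕ (Fin 4 × Fin 3) → V :=
    Sum.elim (fun z => p z.1 z.2) (fun z => t (triangleEnd z.1 z.2))
  let b : (Σ k, Fin (L k)) ⊕ (Fin 4 × Fin 3) → V :=
    Sum.elim (fun z => p z.1 (z.2 + 1)) (fun z => t (triangleEnd z.1 (z.2 + 1)))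
  let w : (Σ k, Fin (L k)) ⊕ (Fin 4 × Fin 3) → ℝ := Sum.elim (fun _ => 1) (fun _ => 1 / 2)
  have key := optSubtourLP_le hV (a := a) (b := b) (w := w) ?_ ?_ ?_ ?_
  · refine key.trans (le_of_eq ?_)
    rw [Fintype.sum_sum_type, Fintype.sum_sigma, Fintype.sum_prod_type, Finset.mul_sum]
    simp only [a, b, w, Sum.elim_inl, Sum.elim_inr, one_mul, Finset.mul_sum, t]
  · rintro (⟨k, i⟩ | ⟨q, r⟩) h
    · have := (hinj k i k (i + 1) i.2.le i.2 h).2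
      omega
    · have hr : ∀ r : Fin 3, r ≠ r + 1 := by decide
      have := triangleEnd_bijective.1.ne (show (q, r) ≠ (q, r + 1) from
        fun h => hr r (congrArg Prod.snd h))
      exact this (ht h)
  · rintro (z | z) <;> simp [w]
  · intro v
    obtain ⟨k, i, hi, rfl⟩ := hsurj v
    have h1 : ∑ z : Σ k, Fin (L k), (if p z.1 z.2 = p k i then (1 : ℝ) else 0) =
        if i < L k then 1 else 0 := by
      rw [Fintype.sum_sigma, Finset.sum_eq_single k]
      · have : ∀ j : Fin (L k), p k j = p k i ↔ (j : ℕ) = i := fun j =>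
          ⟨fun h => (hinj _ _ _ _ j.2.le hi h).2, fun h => by rw [h]⟩
        simp only [this]
        rw [Fin.sum_univ_eq_sum_range (fun j => if j = i then (1 : ℝ) else 0)]
        simp
      · intro k' _ hk
        exact Finset.sum_eq_zero fun j _ => if_neg fun h => hk (hinj _ _ _ _ j.2.le hi h).1
      · simp
    have h2 : ∑ z : Σ k, Fin (L k), (if p z.1 (z.2 + 1) = p k i then (1 : ℝ) else 0) =
        if i = 0 then 0 else 1 := by
      rw [Fintype.sum_sigma, Finset.sum_eq_single k]
      · have : ∀ j : Fin (L k), p k (j + 1) = p k i ↔ (j : ℕ) + 1 = i := fun j =>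
          ⟨fun h => (hinj _ _ _ _ j.2 hi h).2, fun h => by rw [h]⟩
        simp only [this]
        rw [Fin.sum_univ_eq_sum_range (fun j => if j + 1 = i then (1 : ℝ) else 0)]
        cases i with
        | zero => simp
        | succ i => simp [show i < L k by omega]
      · intro k' _ hk
        exact Finset.sum_eq_zero fun j _ => if_neg fun h => hk (hinj _ _ _ _ j.2 hi h).1
      · simp
    have h3 : ∑ z : Fin 4 × Fin 3, (if t (triangleEnd z.1 z.2) = p k i then (1 : ℝ) else 0) =
        (if i = 0 then 1 else 0) + if i = L k then 1 else 0 := by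
      rw [(Function.Bijective.sum_comp triangleEnd_bijective
        (fun z => if t z = p k i then (1 : ℝ) else 0)), Fintype.sum_prod_type,
        Finset.sum_eq_single k]
      · have e1 : p k (L k) = p k i ↔ i = L k :=
          ⟨fun h => (hinj _ _ _ _ le_rfl hi h).2.symm, fun h => by rw [h]⟩
        have e2 : p k 0 = p k i ↔ i = 0 :=
          ⟨fun h => (hinj _ _ _ _ (Nat.zero_le _) hi h).2.symm, fun h => by rw [h]⟩
        rw [Fintype.sum_bool]
        simp [t, e1, e2, add_comm]
      · intro k' _ hk
        refine Finset.sum_eq_zero fun s _ => if_neg fun h => hk ?_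
        exact (hinj _ _ _ _ (by split_ifs <;> omega) hi h).1
      · simp
    have h4 : ∑ z : Fin 4 × Fin 3, (if t (triangleEnd z.1 (z.2 + 1)) = p k i then (1 : ℝ) else 0) =
        ∑ z : Fin 4 × Fin 3, (if t (triangleEnd z.1 z.2) = p k i then (1 : ℝ) else 0) := by
      rw [Fintype.sum_prod_type, Fintype.sum_prod_type]
      refine Finset.sum_congr rfl fun q _ => ?_
      exact Equiv.sum_comp (Equiv.addRight (1 : Fin 3))
        (fun r => if t (triangleEnd q r) = p k i then (1 : ℝ) else 0)
    have h5 : ∀ z, w (.inl z) * ((if a (.inl z) = p k i then (1 : ℝ) else 0) +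
        (if b (.inl z) = p k i then 1 else 0)) =
        (if p z.1 z.2 = p k i then (1 : ℝ) else 0) + (if p z.1 (z.2 + 1) = p k i then 1 else 0) :=
      fun z => one_mul _
    have h6 : ∀ z, w (.inr z) * ((if a (.inr z) = p k i then (1 : ℝ) else 0) +
        (if b (.inr z) = p k i then 1 else 0)) =
        1 / 2 * ((if t (triangleEnd z.1 z.2) = p k i then (1 : ℝ) else 0) +
        (if t (triangleEnd z.1 (z.2 + 1)) = p k i then 1 else 0)) :=
      fun z => rfl
    rw [Fintype.sum_sum_type, Finset.sum_congr rfl fun z _ => h5 z,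
      Finset.sum_congr rfl fun z _ => h6 z, ← Finset.mul_sum, Finset.sum_add_distrib, Finset.sum_add_distrib, h4, h1, h2, h3]
    have := hL k
    rcases Nat.eq_zero_or_pos i with rfl | h
    · norm_num [show 0 < L k by omega, show 0 ≠ L k by omega]
    · rcases hi.lt_or_eq with h' | h'
      · norm_num [h', h.ne', h'.ne]
      · norm_num [← h', h.ne']
  · intro χ htrue hfalse
    rw [Fintype.sum_sum_type, Fintype.sum_sigma, Fintype.sum_prod_type]
    simp only [a, b, w, Sum.elim_inl, Sum.elim_inr]
    have hpath : ∀ k, ((χ (p k 0) ^^ χ (p k (L k))).toNat : ℝ) ≤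
        ∑ i : Fin (L k), 1 * ((χ (p k i) ^^ χ (p k (i + 1))).toNat : ℝ) := fun k => by
      simpa only [one_mul] using sum_change_ge_one (P := fun i => χ (p k i))
    have htri0 : 0 ≤ ∑ q, ∑ r, (1 / 2 : ℝ) *
        (χ (t (triangleEnd q r)) ^^ χ (t (triangleEnd q (r + 1)))).toNat :=
      Finset.sum_nonneg fun q _ => Finset.sum_nonneg fun r _ => by positivity
    have hpath0 : ∀ k, 0 ≤ ∑ i : Fin (L k), 1 * ((χ (p k i) ^^ χ (p k (i + 1))).toNat : ℝ) :=
      fun k => Finset.sum_nonneg fun i _ => by positivity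
    rcases cut_ends (χ (p 0 0)) (χ (p 0 (L 0))) (χ (p 1 0)) (χ (p 1 (L 1))) (χ (p 2 0))
      (χ (p 2 (L 2))) (χ (p 3 0)) (χ (p 3 (L 3))) (χ (p 4 0)) (χ (p 4 (L 4))) (χ (p 5 0))
      (χ (p 5 (L 5))) with h | h
    · obtain ⟨h1, h2, h3, h4, h5, h6, h7, h8, h9, h10, h11⟩ := h
      obtain ⟨v, hv⟩ : ∃ v, χ v ≠ χ (p 0 0) := by
        obtain ⟨u, hu⟩ := htrue
        obtain ⟨v, hv⟩ := hfalse
        by_cases h : χ (p 0 0) = true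
        · exact ⟨v, by rw [hv, h]; decide⟩
        · exact ⟨u, by rw [hu]; exact Ne.symm h⟩
      obtain ⟨k, i, hi, rfl⟩ := hsurj v
      have hends : χ (p k 0) = χ (p 0 0) ∧ χ (p k (L k)) = χ (p 0 0) := by
        fin_cases k <;> simp [← h1, ← h2, ← h3, ← h4, ← h5, ← h6, ← h7, ← h8, ← h9, ← h10, ← h11]
      have h2 := sum_change_ge_two (P := fun i => χ (p k i)) hi
        (by rw [hends.1]; exact hv.symm) (by rw [hends.2]; exact hv)
      have := Finset.single_le_sum (f := fun k => ∑ i : Fin (L k),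
        1 * ((χ (p k i) ^^ χ (p k (i + 1))).toNat : ℝ)) (fun k _ => hpath0 k) (Finset.mem_univ k)
      simp only [one_mul] at this htri0 ⊢
      exact h2.trans (this.trans (le_add_of_nonneg_right htri0))
    · have h1 := Finset.sum_le_sum fun k (_ : k ∈ Finset.univ) => hpath k
      refine le_trans ?_ (add_le_add_left h1 _)
      have h' := (Nat.cast_le (α := ℝ)).mpr h
      push_cast at h'
      simp [Fin.sum_univ_succ, triangleEnd, t] at h' ⊢
      linarith

end SixPaths

/-! ### The geometry of the tetrahedron instances -/

section Geometry

theorem dist_sq_plane (p q : Plane) : dist p q ^ 2 = (p 0 - q 0) ^ 2 + (p 1 - q 1) ^ 2 := by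
  rw [EuclideanSpace.dist_eq, Real.sq_sqrt (Finset.sum_nonneg fun i _ => sq_nonneg _)]
  simp [Fin.sum_univ_two, Real.dist_eq]

theorem abs_sub_le_dist (p q : Plane) (i : Fin 2) : |p i - q i| ≤ dist p q := by
  refine abs_le_of_sq_le_sq ?_ dist_nonneg
  rw [dist_sq_plane]
  fin_cases i
  · exact le_add_of_nonneg_right (sq_nonneg _)
  · exact le_add_of_nonneg_left (sq_nonneg _)

theorem dist_eq_of_sq {p q : Plane} {d : ℝ} (hd : 0 ≤ d)
    (h : (p 0 - q 0) ^ 2 + (p 1 - q 1) ^ 2 = d ^ 2) : dist p q = d := by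
  rw [← dist_sq_plane] at h
  exact (sq_eq_sq₀ dist_nonneg hd).mp h

theorem le_dist_of_sq {p q : Plane} {d : ℝ}
    (h : d ^ 2 ≤ (p 0 - q 0) ^ 2 + (p 1 - q 1) ^ 2) : d ≤ dist p q := by
  rw [← dist_sq_plane] at h
  exact le_of_sq_le_sq h dist_nonneg

theorem plane_ext {p q : Plane} (h0 : p 0 = q 0) (h1 : p 1 = q 1) : p = q := by
  ext i
  fin_cases i
  · exact h0
  · exact h1

variable (n m : ℕ)

/-- The rotation by 120 degrees about the centre. -/
def rot (p : Plane) : Plane := !₂[(n : ℝ) - p 0 / 2 - √3 / 2 * p 1, √3 / 2 * p 0 - p 1 / 2]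

/-- The points on the three sides. -/
def sidePt : Fin 3 → ℕ → Plane := ![ptC, ptA n, ptB n]

/-- The points on the three internal segments. -/
def segPt : Fin 3 → ℕ → Plane := ![ptE n m, ptF n m, ptG n m]

theorem sqrt_three_sq : √3 ^ 2 = 3 := Real.sq_sqrt (by norm_num)

@[simp] theorem rot_zero (p : Plane) : rot n p 0 = (n : ℝ) - p 0 / 2 - √3 / 2 * p 1 := by simp [rot]
@[simp] theorem rot_one (p : Plane) : rot n p 1 = √3 / 2 * p 0 - p 1 / 2 := by simp [rot]

theorem dist_rot (p q : Plane) : dist (rot n p) (rot n q) = dist p q := by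
  refine dist_eq_of_sq dist_nonneg ?_
  rw [dist_sq_plane, rot_zero, rot_zero, rot_one, rot_one]
  linear_combination ((p 0 - q 0) ^ 2 / 4 + (p 1 - q 1) ^ 2 / 4) * sqrt_three_sq

@[simp] theorem ptC_zero (i : ℕ) : ptC i 0 = i := by simp [ptC]
@[simp] theorem ptC_one (i : ℕ) : ptC i 1 = 0 := by simp [ptC]
@[simp] theorem ptA_zero (i : ℕ) : ptA n i 0 = n - i / 2 := by simp [ptA]
@[simp] theorem ptA_one (i : ℕ) : ptA n i 1 = i * √3 / 2 := by simp [ptA]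
@[simp] theorem ptB_zero (i : ℕ) : ptB n i 0 = (n - i) / 2 := by simp [ptB]; ring
@[simp] theorem ptB_one (i : ℕ) : ptB n i 1 = (n - i) * √3 / 2 := by simp [ptB]

variable {n m}

theorem gam_mul (hm : 0 < m) : √3 * m * gam n m = n := by
  have : (0 : ℝ) < m := by exact_mod_cast hm
  unfold gam
  field_simp

theorem mul_gam (hm : 0 < m) : m * gam n m = n / √3 := by
  rw [eq_div_iff (by positivity), ← gam_mul (n := n) hm]
  ring

theorem ptE_zero (hm : 0 < m) (j : ℕ) : ptE n m j 0 = √3 / 2 * (j * gam n m) := by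
  have h : (0 : ℝ) < m := by exact_mod_cast hm
  simp only [ptE, gam]
  simp
  field_simp

theorem ptE_one (hm : 0 < m) (j : ℕ) : ptE n m j 1 = j * gam n m / 2 := by
  have h : (0 : ℝ) < m := by exact_mod_cast hm
  simp only [ptE, gam]
  simp
  field_simp

theorem ptF_zero (hm : 0 < m) (j : ℕ) : ptF n m j 0 = n - √3 / 2 * (j * gam n m) := by
  have h : (0 : ℝ) < m := by exact_mod_cast hm
  simp only [ptF, gam]
  simp
  field_simp

theorem ptF_one (hm : 0 < m) (j : ℕ) : ptF n m j 1 = j * gam n m / 2 := by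
  have h : (0 : ℝ) < m := by exact_mod_cast hm
  simp only [ptF, gam]
  simp
  field_simp

theorem ptG_zero (j : ℕ) : ptG n m j 0 = (n : ℝ) / 2 := by simp [ptG]

theorem ptG_one (hm : 0 < m) (j : ℕ) : ptG n m j 1 = n * √3 / 2 - j * gam n m := by
  have h : (0 : ℝ) < m := by exact_mod_cast hm
  simp only [ptG, gam]
  simp
  field_simp

theorem rot_sidePt (s : Fin 3) (i : ℕ) : rot n (sidePt n s i) = sidePt n (s + 1) i := by
  fin_cases s
  · change rot n (ptC i) = ptA n i
    refine plane_ext ?_ ?_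
    · simp
    · simp
      ring
  · change rot n (ptA n i) = ptB n i
    refine plane_ext ?_ ?_ <;> simp
    · linear_combination (-(i : ℝ) / 4) * sqrt_three_sq
    · ring
  · change rot n (ptB n i) = ptC i
    refine plane_ext ?_ ?_ <;> simp
    · linear_combination (-((n : ℝ) - i) / 4) * sqrt_three_sq
    · ring

theorem rot_segPt (hm : 0 < m) (s : Fin 3) (j : ℕ) :
    rot n (segPt n m s j) = segPt n m (s + 1) j := by
  fin_cases s
  · change rot n (ptE n m j) = ptF n m j
    refine plane_ext ?_ ?_ <;>
      simp only [rot_zero, rot_one, ptE_zero hm, ptE_one hm, ptF_zero hm, ptF_one hm]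
    · ring
    · linear_combination (j * gam n m / 4) * sqrt_three_sq
  · change rot n (ptF n m j) = ptG n m j
    refine plane_ext ?_ ?_ <;>
      simp only [rot_zero, rot_one, ptG_zero, ptG_one hm, ptF_zero hm, ptF_one hm]
    · ring
    · linear_combination (-(j * gam n m) / 4) * sqrt_three_sq
  · change rot n (ptG n m j) = ptE n m j
    refine plane_ext ?_ ?_ <;>
      simp only [rot_zero, rot_one, ptG_zero, ptG_one hm, ptE_zero hm, ptE_one hm]
    · linear_combination (-(n : ℝ) / 4) * sqrt_three_sq
    · ring

/-- A statement about pairs of points that is invariant under `rot` may be proved for pairs whose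
first point lies on a fixed side or segment. -/
theorem dist_shift {p q : Fin 3 → Plane} (hp : ∀ s, rot n (p s) = p (s + 1))
    (hq : ∀ s, rot n (q s) = q (s + 1)) (s s' : Fin 3) :
    dist (p s) (q s') = dist (p 0) (q (s' - s)) := by
  have h : ∀ s s', dist (p (s + 1)) (q (s' + 1)) = dist (p s) (q s') := fun s s' => by
    rw [← hp, ← hq, dist_rot]
  have h0 := h 0 (s' - s)
  have h1 := h 1 (s' - s + 1)
  fin_cases s
  · simp
  · rw [← h0]
    fin_cases s' <;> rfl
  · rw [← h0]
    refine Eq.trans ?_ h1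
    fin_cases s' <;> rfl

theorem dist_ptC (i i' : ℕ) : dist (ptC i) (ptC i') = |(i : ℝ) - i'| := by
  refine dist_eq_of_sq (abs_nonneg _) ?_
  simp

theorem one_le_quadratic {a b : ℤ} (h : a ≠ 0 ∨ b ≠ 0) : 1 ≤ a ^ 2 + b ^ 2 - a * b := by
  by_contra! hc
  have h1 : a ^ 2 + b ^ 2 + (a - b) ^ 2 ≤ 0 := by nlinarith
  have ha : a = 0 := by nlinarith [sq_nonneg a, sq_nonneg b, sq_nonneg (a - b)]
  have hb : b = 0 := by nlinarith [sq_nonneg a, sq_nonneg b, sq_nonneg (a - b)]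
  simp [ha, hb] at h

theorem one_le_dist_sidePt {s s' : Fin 3} {i i' : ℕ} (hi : i < n) (hi' : i' < n)
    (h : s ≠ s' ∨ i ≠ i') : 1 ≤ dist (sidePt n s i) (sidePt n s' i') := by
  rw [dist_shift (p := fun s => sidePt n s i) (q := fun s => sidePt n s i')
    (fun s => rot_sidePt s i) (fun s => rot_sidePt s i')]
  generalize hd : s' - s = d
  fin_cases d
  · change 1 ≤ dist (ptC i) (ptC i')
    have hii : i ≠ i' := by
      rcases h with h | h
      · exact absurd (sub_eq_zero.mp hd).symm h
      · exact h
    rw [dist_ptC]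
    have : (1 : ℤ) ≤ |(i : ℤ) - i'| := Int.one_le_abs (by omega)
    exact_mod_cast this
  · change 1 ≤ dist (ptC i) (ptA n i')
    refine le_dist_of_sq ?_
    have := one_le_quadratic (a := (n : ℤ) - i) (b := i') (Or.inl (by omega))
    have h' : (1 : ℝ) ≤ ((n : ℝ) - i) ^ 2 + (i' : ℝ) ^ 2 - ((n : ℝ) - i) * i' := by
      exact_mod_cast this
    simp only [ptC_zero, ptC_one, ptA_zero, ptA_one]
    nlinarith [sqrt_three_sq]
  · change 1 ≤ dist (ptC i) (ptB n i')
    refine le_dist_of_sq ?_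
    have := one_le_quadratic (a := i) (b := (n : ℤ) - i') (Or.inr (by omega))
    have h' : (1 : ℝ) ≤ (i : ℝ) ^ 2 + ((n : ℝ) - i') ^ 2 - i * ((n : ℝ) - i') := by
      exact_mod_cast this
    simp only [ptC_zero, ptC_one, ptB_zero, ptB_one]
    nlinarith [sqrt_three_sq]

theorem dist_segPt_same (hm : 0 < m) (s : Fin 3) (j j' : ℕ) :
    dist (segPt n m s j) (segPt n m s j') = |(j : ℝ) - j'| * gam n m := by
  rw [dist_shift (p := fun s => segPt n m s j) (q := fun s => segPt n m s j')
    (fun s => rot_segPt hm s j) (fun s => rot_segPt hm s j'), sub_self]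
  change dist (ptE n m j) (ptE n m j') = _
  refine dist_eq_of_sq (mul_nonneg (abs_nonneg _) (by unfold gam; positivity)) ?_
  rw [mul_pow, sq_abs, ptE_zero hm, ptE_zero hm, ptE_one hm, ptE_one hm]
  linear_combination ((j - j' : ℝ) ^ 2 * gam n m ^ 2 / 4) * sqrt_three_sq

theorem dist_segPt_sq (hm : 0 < m) {s s' : Fin 3} (h : s ≠ s') (j j' : ℕ) :
    dist (segPt n m s j) (segPt n m s' j') ^ 2 = (((m : ℝ) - j) * gam n m) ^ 2 +
      (((m : ℝ) - j') * gam n m) ^ 2 + ((m : ℝ) - j) * gam n m * (((m : ℝ) - j') * gam n m) := by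
  have key : ∀ j j', dist (ptE n m j) (ptF n m j') ^ 2 = (((m : ℝ) - j) * gam n m) ^ 2 +
      (((m : ℝ) - j') * gam n m) ^ 2 + ((m : ℝ) - j) * gam n m * (((m : ℝ) - j') * gam n m) := by
    intro j j'
    rw [dist_sq_plane, ptE_zero hm, ptE_one hm, ptF_zero hm, ptF_one hm, ← gam_mul (n := n) hm]
    linear_combination ((j + j' - 2 * m : ℝ) ^ 2 * gam n m ^ 2 / 4) * sqrt_three_sq
  rw [dist_shift (p := fun s => segPt n m s j) (q := fun s => segPt n m s j')
    (fun s => rot_segPt hm s j) (fun s => rot_segPt hm s j')]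
  generalize hd : s' - s = d
  fin_cases d
  · exact absurd (sub_eq_zero.mp hd).symm h
  · exact key j j'
  · have : dist (segPt n m 0 j) (segPt n m 2 j') = dist (ptE n m j') (ptF n m j) := by
      rw [← dist_rot n, rot_segPt hm, rot_segPt hm, dist_comm]
      rfl
    refine (congrArg (· ^ 2) this).trans ?_
    rw [key]
    ring

end Geometry

section Membership

/-- The range of parameters of the theorem. -/
structure Admissible (n m : ℕ) : Prop where
  n_ge : 40 ≤ n
  m_ge : 22 ≤ m
  n_le : (n : ℝ) ≤ 3 / 2 * m

/-- The least index of an internal vertex that is not removed. -/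
def firstIdx (n m : ℕ) : ℕ := ⌈10 / gam n m⌉₊

/-- The distance of the outermost remaining internal vertices from the corners. -/
def firstRadius (n m : ℕ) : ℝ := firstIdx n m * gam n m

variable {n m : ℕ}

namespace Admissible

variable (h : Admissible n m)
include h

theorem n_real : (40 : ℝ) ≤ n := by exact_mod_cast h.n_ge
theorem m_pos : 0 < m := by have := h.m_ge; omega
theorem m_pos' : (0 : ℝ) < m := by exact_mod_cast h.m_pos
theorem n_pos : (0 : ℝ) < n := by linarith [h.n_real]

theorem gam_pos : 0 < gam n m := by
  have := h.n_pos
  have := h.m_pos'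
  unfold gam
  positivity

theorem m_gam : m * gam n m = n * √3 / 3 := by
  rw [mul_gam h.m_pos, div_eq_div_iff (by positivity) (by norm_num)]
  linear_combination (-(n : ℝ)) * sqrt_three_sq

theorem gam_le : gam n m ≤ √3 / 2 := by
  have h1 := h.m_gam
  have h2 := h.m_pos'
  have h3 := h.n_le
  have : m * gam n m ≤ m * (√3 / 2) := by
    rw [h1]
    nlinarith [Real.sqrt_nonneg 3]
  exact le_of_mul_le_mul_left this h2

theorem max_eq : max 10 (4 + 4 * gam n m) = 10 := by
  refine max_eq_left ?_
  linarith [h.gam_le, sqrt_three_bounds.2]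

theorem firstIdx_le_iff (j : ℕ) : firstIdx n m ≤ j ↔ 10 ≤ j * gam n m := by
  rw [firstIdx, Nat.ceil_le, div_le_iff₀ h.gam_pos]

theorem ten_le_firstRadius : 10 ≤ firstRadius n m := (h.firstIdx_le_iff _).mp le_rfl

theorem firstRadius_lt : firstRadius n m < 10 + gam n m := by
  have h1 := h.gam_pos
  have h2 := Nat.ceil_lt_add_one (div_nonneg (by norm_num : (0 : ℝ) ≤ 10) h1.le)
  have h3 := mul_lt_mul_of_pos_right h2 h1
  have h4 : (10 / gam n m + 1) * gam n m = 10 + gam n m := by field_simp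
  rw [h4] at h3
  exact h3

theorem firstRadius_bounds : 10 ≤ firstRadius n m ∧ firstRadius n m ≤ 10 + √3 / 2 :=
  ⟨h.ten_le_firstRadius, by linarith [h.firstRadius_lt, h.gam_le]⟩

theorem m_gam_ge : n * 0.577 ≤ m * gam n m := by
  rw [h.m_gam]
  nlinarith [h.n_pos, sqrt_three_bounds.1]

theorem firstIdx_lt : firstIdx n m < m := by
  have h1 := h.m_gam_ge
  have h2 := h.n_real
  have h3 := h.firstRadius_bounds.2
  have h4 := sqrt_three_bounds.2
  have h5 : firstRadius n m < m * gam n m := by linarith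
  have h6 := lt_of_mul_lt_mul_right h5 h.gam_pos.le
  exact_mod_cast h6

theorem firstIdx_pos : 0 < firstIdx n m := by
  by_contra hc
  have h0 : firstIdx n m = 0 := by omega
  have := h.ten_le_firstRadius
  rw [firstRadius, h0] at this
  norm_num at this

theorem j_gam_bounds {j : ℕ} (hj : j ≤ m) : 0 ≤ j * gam n m ∧ j * gam n m ≤ n * √3 / 3 := by
  have h1 := h.gam_pos
  refine ⟨by positivity, ?_⟩
  rw [← h.m_gam]
  exact mul_le_mul_of_nonneg_right (by exact_mod_cast hj) h1.le

theorem j_gam_ge {j : ℕ} (hj : firstIdx n m ≤ j) : firstRadius n m ≤ j * gam n m :=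
  mul_le_mul_of_nonneg_right (by exact_mod_cast hj) h.gam_pos.le

end Admissible

theorem sidePt_last (s : Fin 3) : sidePt n s n = sidePt n (s + 1) 0 := by
  fin_cases s
  · refine plane_ext ?_ ?_ <;> simp [sidePt]
  · refine plane_ext ?_ ?_ <;> simp [sidePt]
    ring
  · refine plane_ext ?_ ?_ <;> simp [sidePt]

theorem mem_baseVertices {p : Plane} :
    p ∈ baseVertices n ↔ ∃ s i, i ≤ n ∧ p = sidePt n s i := by
  classical
  simp only [baseVertices, Finset.mem_union, Finset.mem_image, Finset.mem_range, Nat.lt_succ_iff]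
  constructor
  · rintro ((⟨i, hi, rfl⟩ | ⟨i, hi, rfl⟩) | ⟨i, hi, rfl⟩)
    · exact ⟨1, i, hi, rfl⟩
    · exact ⟨2, i, hi, rfl⟩
    · exact ⟨0, i, hi, rfl⟩
  · rintro ⟨s, i, hi, rfl⟩
    fin_cases s
    · exact Or.inr ⟨i, hi, rfl⟩
    · exact Or.inl (Or.inl ⟨i, hi, rfl⟩)
    · exact Or.inl (Or.inr ⟨i, hi, rfl⟩)

theorem mem_internalVertices {p : Plane} :
    p ∈ internalVertices n m ↔ ∃ s j, 1 ≤ j ∧ j ≤ m ∧ p = segPt n m s j := by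
  classical
  simp only [internalVertices, Finset.mem_union, Finset.mem_image, Finset.mem_Icc]
  constructor
  · rintro ((⟨i, hi, rfl⟩ | ⟨i, hi, rfl⟩) | ⟨i, hi, rfl⟩)
    · exact ⟨0, i, hi.1, hi.2, rfl⟩
    · exact ⟨1, i, hi.1, hi.2, rfl⟩
    · exact ⟨2, i, hi.1, hi.2, rfl⟩
  · rintro ⟨s, i, hi, hi', rfl⟩
    fin_cases s
    · exact Or.inl (Or.inl ⟨i, ⟨hi, hi'⟩, rfl⟩)
    · exact Or.inl (Or.inr ⟨i, ⟨hi, hi'⟩, rfl⟩)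
    · exact Or.inr ⟨i, ⟨hi, hi'⟩, rfl⟩

namespace Admissible

variable (h : Admissible n m)
include h

theorem segPt_one_ge (s : Fin 3) {j : ℕ} (hj : j ≤ m) :
    j * gam n m / 2 ≤ segPt n m s j 1 := by
  have h1 := h.j_gam_bounds hj
  fin_cases s
  · exact (ptE_one h.m_pos j).ge
  · exact (ptF_one h.m_pos j).ge
  · change _ ≤ ptG n m j 1
    rw [ptG_one h.m_pos]
    linarith

/-- The internal vertices keep their distance from the sides. -/
theorem dist_sidePt_segPt (s s' : Fin 3) (i : ℕ) {j : ℕ} (hj : j ≤ m) :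
    j * gam n m / 2 ≤ dist (sidePt n s i) (segPt n m s' j) := by
  rw [dist_shift (p := fun s => sidePt n s i) (q := fun s => segPt n m s j)
    (fun s => rot_sidePt s i) (fun s => rot_segPt h.m_pos s j)]
  have h1 := abs_sub_le_dist (sidePt n 0 i) (segPt n m (s' - s) j) 1
  have h2 := h.segPt_one_ge (s' - s) hj
  rw [show sidePt n 0 i 1 = 0 from ptC_one i, zero_sub, abs_neg] at h1
  exact h2.trans ((le_abs_self _).trans h1)

theorem dist_corner_segPt (s s' : Fin 3) {j : ℕ} (hj : j ≤ m) (hss : s ≠ s') :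
    (n : ℝ) / 2 ≤ dist (sidePt n s 0) (segPt n m s' j) := by
  rw [dist_shift (p := fun s => sidePt n s 0) (q := fun s => segPt n m s j)
    (fun s => rot_sidePt s 0) (fun s => rot_segPt h.m_pos s j)]
  have h1 := abs_sub_le_dist (sidePt n 0 0) (segPt n m (s' - s) j) 0
  have hb := h.j_gam_bounds hj
  rw [show sidePt n 0 0 0 = 0 by simp [sidePt], zero_sub, abs_neg] at h1
  refine le_trans ?_ ((le_abs_self _).trans h1)
  generalize hd : s' - s = d
  fin_cases d
  · exact absurd (sub_eq_zero.mp hd).symm hss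
  · change _ ≤ ptF n m j 0
    rw [ptF_zero h.m_pos]
    nlinarith [sqrt_three_sq, Real.sqrt_nonneg 3]
  · exact (ptG_zero j).ge

theorem dist_corner_segPt_same (s : Fin 3) (j : ℕ) :
    dist (sidePt n s 0) (segPt n m s j) = j * gam n m := by
  rw [dist_shift (p := fun s => sidePt n s 0) (q := fun s => segPt n m s j)
    (fun s => rot_sidePt s 0) (fun s => rot_segPt h.m_pos s j), sub_self]
  have := h.gam_pos
  change dist (ptC 0) (ptE n m j) = _
  refine dist_eq_of_sq (by positivity) ?_
  rw [ptC_zero, ptC_one, ptE_zero h.m_pos, ptE_one h.m_pos]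
  push_cast
  linear_combination ((j : ℝ) ^ 2 * gam n m ^ 2 / 4) * sqrt_three_sq

theorem mem_modTetrahedron {p : Plane} : p ∈ modTetrahedron n m ↔
    (∃ s i, i < n ∧ p = sidePt n s i) ∨
    (∃ s j, firstIdx n m ≤ j ∧ j ≤ m ∧ p = segPt n m s j) := by
  classical
  have hn := h.n_ge
  have hcorner : ∀ P : Plane → Prop, (∃ q ∈ ({cornerA, cornerB n, cornerC n} : Set Plane), P q) ↔
      ∃ s, P (sidePt n s 0) := by
    intro P
    simp only [Set.mem_insert_iff, Set.mem_singleton_iff, exists_eq_or_imp, exists_eq_left,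
      Fin.exists_fin_succ]
    simp [cornerA, cornerB, cornerC, sidePt]
  have hside : ∀ s i, i ≤ n → ∃ s' i', i' < n ∧ sidePt n s i = sidePt n s' i' := by
    intro s i hi
    rcases hi.lt_or_eq with hi | rfl
    · exact ⟨s, i, hi, rfl⟩
    · exact ⟨s + 1, 0, by omega, sidePt_last s⟩
  have hint : ∀ s i, sidePt n s i ∉ internalVertices n m := by
    intro s i hmem
    obtain ⟨s', j, hj1, hj, heq⟩ := mem_internalVertices.mp hmem
    have h1 := h.dist_sidePt_segPt s s' i hj
    rw [heq, dist_self] at h1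
    have : (1 : ℝ) ≤ j := by exact_mod_cast hj1
    nlinarith [h.gam_pos]
  have hseg : ∀ s j, j ≤ m → ((∃ s', dist (sidePt n s' 0) (segPt n m s j) < 10) ↔
      ¬ firstIdx n m ≤ j) := by
    intro s j hj
    rw [h.firstIdx_le_iff, not_le]
    constructor
    · rintro ⟨s', hs'⟩
      by_cases hss : s' = s
      · subst hss
        rwa [h.dist_corner_segPt_same] at hs'
      · have := h.dist_corner_segPt s' s hj hss
        linarith [h.n_real]
    · intro hlt
      exact ⟨s, by rwa [h.dist_corner_segPt_same]⟩
  rw [modTetrahedron, Finset.mem_filter, h.max_eq, tetrahedron, Finset.mem_union, hcorner]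
  constructor
  · rintro ⟨hb | hi, hnot⟩
    · obtain ⟨s, i, hi, rfl⟩ := mem_baseVertices.mp hb
      exact Or.inl (hside s i hi)
    · refine Or.inr ?_
      obtain ⟨s, j, hj1, hj, rfl⟩ := mem_internalVertices.mp hi
      refine ⟨s, j, ?_, hj, rfl⟩
      by_contra hc
      exact hnot ⟨hi, (hseg s j hj).mpr hc⟩
  · rintro (⟨s, i, hi, rfl⟩ | ⟨s, j, hj, hjm, rfl⟩)
    · exact ⟨Or.inl (mem_baseVertices.mpr ⟨s, i, hi.le, rfl⟩), fun hc => hint s i hc.1⟩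
    · have hpos := h.firstIdx_pos
      exact ⟨Or.inr (mem_internalVertices.mpr ⟨s, j, by omega, hjm, rfl⟩),
        fun hc => (hseg s j hjm).mp hc.2 hj⟩

theorem rot_mem {p : Plane} (hp : p ∈ modTetrahedron n m) : rot n p ∈ modTetrahedron n m := by
  rw [h.mem_modTetrahedron] at hp ⊢
  rcases hp with ⟨s, i, hi, rfl⟩ | ⟨s, j, hj, hjm, rfl⟩
  · exact Or.inl ⟨s + 1, i, hi, rot_sidePt s i⟩
  · exact Or.inr ⟨s + 1, j, hj, hjm, rot_segPt h.m_pos s j⟩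

theorem sidePt_mem (s : Fin 3) {i : ℕ} (hi : i ≤ n) : sidePt n s i ∈ modTetrahedron n m := by
  rw [h.mem_modTetrahedron]
  have hn := h.n_ge
  rcases hi.lt_or_eq with hi | rfl
  · exact Or.inl ⟨s, i, hi, rfl⟩
  · exact Or.inl ⟨s + 1, 0, by omega, sidePt_last s⟩

theorem segPt_mem (s : Fin 3) {j : ℕ} (hj : firstIdx n m ≤ j) (hj' : j ≤ m) :
    segPt n m s j ∈ modTetrahedron n m := by
  rw [h.mem_modTetrahedron]
  exact Or.inr ⟨s, j, hj, hj', rfl⟩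

theorem segPt_centre (s : Fin 3) : segPt n m s m = segPt n m 0 m := by
  have := dist_segPt_sq (n := n) h.m_pos (s := s) (s' := 0)
  by_cases hs : s = 0
  · rw [hs]
  · have h1 := this hs m m
    simpa using h1

end Admissible

end Membership

/-! ### The lower bound for tours of the tetrahedron instances -/

section TourLower

/-- The line through the corner `A` that contains a given point: the side `c`, the side `b`, or the
internal segment. -/
def cornerLine (p : Plane) : Fin 3 := if p 1 = 0 then 0 else if p 0 = √3 * p 1 then 2 else 1

/-- The directions of the three lines at the corner `A`. -/
def cornerDir : Fin 3 → Fin 2 → ℝ := ![![1, 0], ![1 / 2, √3 / 2], ![√3 / 2, 1 / 2]]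

theorem dist_sq_of_cornerDir {p q : Plane} {r r' : ℝ} {a b : Fin 3} (hab : a ≠ b) (hr : 0 ≤ r)
    (hr' : 0 ≤ r') (hp : ∀ i, p i = r * cornerDir a i) (hq : ∀ i, q i = r' * cornerDir b i) :
    r ^ 2 + r' ^ 2 - √3 * (r * r') ≤ dist p q ^ 2 := by
  rw [dist_sq_plane, hp, hp, hq, hq]
  have h3 := sqrt_three_sq
  have hrr : 0 ≤ (√3 - 1) * (r * r') :=
    mul_nonneg (by linarith [sqrt_three_bounds.1]) (mul_nonneg hr hr')
  have hsq : √3 * √3 = 3 := by rw [← sq]; exact h3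
  fin_cases a <;> fin_cases b <;> simp [cornerDir] at hab ⊢ <;> ring_nf <;> simp only [h3] <;>
    linarith

variable {n m : ℕ}

theorem cornerLine_sidePt_zero (i : ℕ) : cornerLine (sidePt n 0 i) = 0 := by
  simp [cornerLine, sidePt]

theorem cornerLine_sidePt_two {i : ℕ} (hi : i < n) : cornerLine (sidePt n 2 i) = 1 := by
  have h1 : (0 : ℝ) < n - i := sub_pos.mpr (by exact_mod_cast hi)
  have h2 : (0 : ℝ) < √3 := by positivity
  simp only [cornerLine, sidePt]
  simp only [Matrix.cons_val, ptB_one, ptB_zero]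
  rw [if_neg (by positivity), if_neg]
  intro h
  have h3 := sqrt_three_sq
  nlinarith

theorem dist_corner_sidePt_two {i : ℕ} (hi : i ≤ n) :
    dist (sidePt n 0 0) (sidePt n 2 i) = (n : ℝ) - i := by
  have h1 : (0 : ℝ) ≤ n - i := sub_nonneg.mpr (by exact_mod_cast hi)
  change dist (ptC 0) (ptB n i) = _
  refine dist_eq_of_sq h1 ?_
  rw [ptC_zero, ptC_one, ptB_zero, ptB_one]
  push_cast
  linear_combination ((n - i : ℝ) ^ 2 / 4) * sqrt_three_sq

theorem dist_corner_sidePt_zero (i : ℕ) : dist (sidePt n 0 0) (sidePt n 0 i) = i := by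
  change dist (ptC 0) (ptC i) = _
  rw [dist_ptC]
  simp

namespace Admissible

variable (h : Admissible n m)
include h

theorem cornerLine_segPt_zero {j : ℕ} (hj : 0 < j) : cornerLine (segPt n m 0 j) = 2 := by
  have h1 := h.gam_pos
  have h2 : (0 : ℝ) < j := by exact_mod_cast hj
  change cornerLine (ptE n m j) = 2
  rw [cornerLine, ptE_one h.m_pos, ptE_zero h.m_pos, if_neg (by positivity), if_pos (by ring)]

theorem near_corner {p : Plane} (hp : p ∈ modTetrahedron n m)
    (hd : dist (sidePt n 0 0) p < n / 2) :
    (∀ i, p i = dist (sidePt n 0 0) p * cornerDir (cornerLine p) i) ∧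
    ((∃ i : ℕ, dist (sidePt n 0 0) p = i) ∨ firstRadius n m ≤ dist (sidePt n 0 0) p) := by
  rcases h.mem_modTetrahedron.mp hp with ⟨s, i, hi, rfl⟩ | ⟨s, j, hj, hjm, rfl⟩
  · have hi' : (i : ℝ) ≤ n := by exact_mod_cast hi.le
    fin_cases s
    · change (∀ k, sidePt n 0 i k = dist (sidePt n 0 0) (sidePt n 0 i) *
        cornerDir (cornerLine (sidePt n 0 i)) k) ∧ ((∃ k : ℕ, dist (sidePt n 0 0) (sidePt n 0 i) = k)
        ∨ _ ≤ dist (sidePt n 0 0) (sidePt n 0 i))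
      rw [dist_corner_sidePt_zero, cornerLine_sidePt_zero]
      refine ⟨fun k => ?_, Or.inl ⟨i, rfl⟩⟩
      fin_cases k <;> simp [sidePt, cornerDir]
    · exfalso
      have h1 := abs_sub_le_dist (sidePt n 0 0) (sidePt n 1 i) 0
      simp only [sidePt, Matrix.cons_val, ptC_zero, ptA_zero] at h1
      have h2 := neg_le_abs (((0 : ℕ) : ℝ) - (n - i / 2))
      push_cast at h1 h2
      have hd' : dist (ptC 0) (ptA n i) < n / 2 := hd
      linarith
    · change (∀ k, sidePt n 2 i k = dist (sidePt n 0 0) (sidePt n 2 i) *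
        cornerDir (cornerLine (sidePt n 2 i)) k) ∧ ((∃ k : ℕ, dist (sidePt n 0 0) (sidePt n 2 i) = k)
        ∨ _ ≤ dist (sidePt n 0 0) (sidePt n 2 i))
      rw [dist_corner_sidePt_two hi.le, cornerLine_sidePt_two hi]
      refine ⟨fun k => ?_, Or.inl ⟨n - i, by rw [Nat.cast_sub hi.le]⟩⟩
      fin_cases k <;> simp [sidePt, cornerDir] <;> ring
  · by_cases hs : s = 0
    · subst hs
      have hpos := h.firstIdx_pos
      rw [h.dist_corner_segPt_same, h.cornerLine_segPt_zero (by omega)]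
      refine ⟨fun k => ?_, Or.inr (h.j_gam_ge hj)⟩
      fin_cases k
      · exact (ptE_zero h.m_pos j).trans (mul_comm _ _)
      · exact (ptE_one h.m_pos j).trans (by simp [cornerDir]; ring)
    · exact absurd hd (not_lt.mpr (h.dist_corner_segPt 0 s hjm (Ne.symm hs)))

theorem half_n_lt : (n : ℝ) / 2 < m * gam n m := by linarith [h.m_gam_ge, h.n_pos]

theorem corner_bound {σ : Equiv.Perm (modTetrahedron n m)} (hσ : σ.IsCycleOn Set.univ)
    (ψ : modTetrahedron n m → modTetrahedron n m) (hψ : ∀ u v, dist (ψ u) (ψ v) = dist u v)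
    (hsurj : Function.Surjective ψ) :
    4 * ((n : ℝ) / 2) - ((1 + √3 / 2) * firstRadius n m + 2) ≤
      ∑ v, moatLength (fun v : modTetrahedron n m => dist (sidePt n 0 0) (ψ v : Plane)) (n / 2)
        v (σ v) := by
  have hex : ∀ P : Plane → Prop, (∃ p ∈ modTetrahedron n m, P p) →
      ∃ v : modTetrahedron n m, P (ψ v) := by
    rintro P ⟨p, hp, hP⟩
    obtain ⟨v, hv⟩ := hsurj ⟨p, hp⟩
    exact ⟨v, by rw [hv]; exact hP⟩
  have hn := h.n_real
  have hg := h.gam_pos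
  have hf : ∀ u v : modTetrahedron n m,
      |dist (sidePt n 0 0) (ψ u : Plane) - dist (sidePt n 0 0) (ψ v : Plane)| ≤ dist u v := by
    intro u v
    rw [← hψ]
    rw [dist_comm _ (ψ u : Plane), dist_comm _ (ψ v : Plane)]
    exact abs_dist_sub_le _ _ _
  refine sum_moatLength_ge hσ hf (by linarith) (fun _ => dist_nonneg) ?_ ?_ ?_
  · exact hex (fun p => dist (sidePt n 0 0) p = 0) ⟨_, h.sidePt_mem 0 (Nat.zero_le n), dist_self _⟩
  · refine hex (fun p => (n : ℝ) / 2 ≤ dist (sidePt n 0 0) p) ⟨_, h.sidePt_mem 0 le_rfl, ?_⟩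
    rw [dist_corner_sidePt_zero]
    linarith
  · refine corner_loss hσ hf (l := fun v => cornerLine (ψ v)) (by linarith)
      h.firstRadius_bounds.1 h.firstRadius_bounds.2 ?_ ?_ ?_ ?_ ?_
    · intro v hv
      exact (h.near_corner (ψ v).2 hv).2
    · intro i hi hin j hj
      have hin' : i < n := by
        have : (i : ℝ) < n := by linarith
        exact_mod_cast this
      refine hex (fun p => cornerLine p = j ∧ dist (sidePt n 0 0) p = i) ?_
      fin_cases j
      · exact ⟨_, h.sidePt_mem 0 hin'.le, cornerLine_sidePt_zero i, dist_corner_sidePt_zero i⟩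
      · refine ⟨_, h.sidePt_mem 2 (Nat.sub_le n i), cornerLine_sidePt_two (by omega), ?_⟩
        rw [dist_corner_sidePt_two (Nat.sub_le n i), Nat.cast_sub hin'.le]
        ring
      · exact absurd rfl hj
    · intro s hs hs'
      refine hex (fun p => cornerLine p = 2 ∧ s < dist (sidePt n 0 0) p ∧
        dist (sidePt n 0 0) p ≤ s + 1) ?_
      have hfl := Nat.floor_le (div_nonneg (by linarith : 0 ≤ s) hg.le)
      have hlt := Nat.lt_floor_add_one (s / gam n m)
      rw [le_div_iff₀ hg] at hfl
      rw [div_lt_iff₀ hg] at hlt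
      have hgle := h.gam_le
      have hs3 := sqrt_three_bounds.2
      have hup : ((⌊s / gam n m⌋₊ + 1 : ℕ) : ℝ) * gam n m ≤ s + 1 := by
        push_cast
        linarith
      have hlow : s < ((⌊s / gam n m⌋₊ + 1 : ℕ) : ℝ) * gam n m := by exact_mod_cast hlt
      refine ⟨_, h.segPt_mem 0 (j := ⌊s / gam n m⌋₊ + 1) ?_ ?_, h.cornerLine_segPt_zero (by omega),
        ?_, ?_⟩
      · exact (h.firstIdx_le_iff _).mpr (by linarith)
      · have : ((⌊s / gam n m⌋₊ + 1 : ℕ) : ℝ) * gam n m ≤ m * gam n m := by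
          linarith [h.half_n_lt]
        exact_mod_cast le_of_mul_le_mul_right this hg
      · rwa [h.dist_corner_segPt_same]
      · rwa [h.dist_corner_segPt_same]
    · refine hex (fun p => cornerLine p = 2 ∧ dist (sidePt n 0 0) p = firstRadius n m)
        ⟨_, h.segPt_mem 0 le_rfl h.firstIdx_lt.le, h.cornerLine_segPt_zero h.firstIdx_pos,
          h.dist_corner_segPt_same 0 _⟩
    · intro u v hu hv hl
      rw [← hψ u v]
      exact dist_sq_of_cornerDir hl dist_nonneg dist_nonneg (h.near_corner (ψ u).2 hu).1
        (h.near_corner (ψ v).2 hv).1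

end Admissible

open scoped Classical in
/-- The internal segment that contains a given point. -/
def centreLine (n m : ℕ) (p : Plane) : Fin 3 :=
  if ∃ j ≤ m, p = segPt n m 0 j then 0 else if ∃ j ≤ m, p = segPt n m 1 j then 1 else 2

namespace Admissible

variable (h : Admissible n m)
include h

theorem segPt_ne {s s' : Fin 3} (hs : s ≠ s') {j j' : ℕ} (hj : j < m) (hj' : j' ≤ m) :
    segPt n m s j ≠ segPt n m s' j' := by
  intro heq
  have h1 := dist_segPt_sq (n := n) h.m_pos hs j j'
  rw [heq, dist_self] at h1
  have h2 : (0 : ℝ) < (m - j) * gam n m :=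
    mul_pos (sub_pos.mpr (by exact_mod_cast hj)) h.gam_pos
  have h3 : (0 : ℝ) ≤ (m - j') * gam n m :=
    mul_nonneg (sub_nonneg.mpr (by exact_mod_cast hj')) h.gam_pos.le
  nlinarith [mul_nonneg h2.le h3]

theorem centreLine_segPt (s : Fin 3) {j : ℕ} (hj : j < m) :
    centreLine n m (segPt n m s j) = s := by
  unfold centreLine
  fin_cases s
  · exact if_pos ⟨j, hj.le, rfl⟩
  · refine (if_neg ?_).trans (if_pos ⟨j, hj.le, rfl⟩)
    rintro ⟨j', hj', heq⟩
    exact h.segPt_ne (by decide) hj hj' heq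
  · refine (if_neg ?_).trans (if_neg ?_)
    · rintro ⟨j', hj', heq⟩
      exact h.segPt_ne (by decide) hj hj' heq
    · rintro ⟨j', hj', heq⟩
      exact h.segPt_ne (by decide) hj hj' heq

theorem dist_centre_segPt (s : Fin 3) {j : ℕ} (hj : j ≤ m) :
    dist (segPt n m 0 m) (segPt n m s j) = ((m - j : ℕ) : ℝ) * gam n m := by
  rw [← h.segPt_centre s, dist_segPt_same h.m_pos, Nat.cast_sub hj, abs_of_nonneg]
  exact sub_nonneg.mpr (by exact_mod_cast hj)

theorem near_centre {p : Plane} (hp : p ∈ modTetrahedron n m)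
    (hd : dist (segPt n m 0 m) p < m * gam n m - n / 2) :
    ∃ j ≤ m, p = segPt n m (centreLine n m p) j ∧
      dist (segPt n m 0 m) p = ((m - j : ℕ) : ℝ) * gam n m := by
  rcases h.mem_modTetrahedron.mp hp with ⟨s, i, hi, rfl⟩ | ⟨s, j, hj, hjm, rfl⟩
  · exfalso
    have h1 := h.dist_sidePt_segPt s 0 i le_rfl
    rw [dist_comm] at h1
    have := h.m_gam
    nlinarith [sqrt_three_bounds.2, h.n_pos]
  · refine ⟨j, hjm, ?_, h.dist_centre_segPt s hjm⟩
    rcases hjm.lt_or_eq with hlt | rfl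
    · rw [h.centreLine_segPt s hlt]
    · rw [h.segPt_centre, h.segPt_centre (centreLine _ _ _)]

theorem centre_bound {σ : Equiv.Perm (modTetrahedron n m)} (hσ : σ.IsCycleOn Set.univ) :
    4 * (m * gam n m - n / 2) - 5 / 2 * gam n m ≤
      ∑ v, moatLength (fun v : modTetrahedron n m => dist (segPt n m 0 m) (v : Plane))
        (m * gam n m - n / 2) v (σ v) := by
  have hn := h.n_real
  have hg := h.gam_pos
  have hf : ∀ u v : modTetrahedron n m,
      |dist (segPt n m 0 m) (u : Plane) - dist (segPt n m 0 m) (v : Plane)| ≤ dist u v := by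
    intro u v
    rw [dist_comm _ (u : Plane), dist_comm _ (v : Plane)]
    exact abs_dist_sub_le _ _ _
  refine sum_moatLength_ge hσ hf (by linarith [h.half_n_lt]) (fun _ => dist_nonneg) ?_ ?_ ?_
  · exact ⟨⟨_, h.segPt_mem 0 h.firstIdx_lt.le le_rfl⟩, dist_self _⟩
  · refine ⟨⟨_, h.sidePt_mem 0 (Nat.zero_le n)⟩, ?_⟩
    change _ ≤ dist (segPt n m 0 m) (sidePt n 0 0)
    rw [dist_comm, h.dist_corner_segPt_same]
    linarith
  · refine centre_loss hσ hf (l := fun v => centreLine n m v) hg ?_ ?_ ?_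
    · intro v hv
      obtain ⟨j, hj, -, hd⟩ := h.near_centre v.2 hv
      exact ⟨m - j, hd⟩
    · intro j hj hjR i
      have h1 : ((j : ℝ)) * gam n m < m * gam n m := by linarith
      have hjm : j < m := by exact_mod_cast lt_of_mul_lt_mul_right h1 hg.le
      refine ⟨⟨_, h.segPt_mem i (j := m - j) ?_ (Nat.sub_le _ _)⟩,
        h.centreLine_segPt i (by omega), ?_⟩
      · rw [h.firstIdx_le_iff, Nat.cast_sub hjm.le]
        linarith
      · change dist _ (segPt n m i (m - j)) = _
        rw [h.dist_centre_segPt i (Nat.sub_le _ _), Nat.sub_sub_self hjm.le]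
    · intro u v hu hv hl
      obtain ⟨j, hj, hju, hd⟩ := h.near_centre u.2 hu
      obtain ⟨j', hj', hjv, hd'⟩ := h.near_centre v.2 hv
      have h1 := dist_segPt_sq (n := n) h.m_pos hl j j'
      rw [← hju, ← hjv] at h1
      rw [hd, hd', Nat.cast_sub hj, Nat.cast_sub hj']
      exact h1.ge

/-- The rotation of the vertex set. -/
def rotVertex (v : modTetrahedron n m) : modTetrahedron n m := ⟨rot n v, h.rot_mem v.2⟩

theorem dist_rotVertex (u v : modTetrahedron n m) :
    dist (h.rotVertex u) (h.rotVertex v) = dist u v := dist_rot n _ _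

theorem rotVertex_surjective : Function.Surjective h.rotVertex := by
  refine Finite.injective_iff_surjective.mp fun u v huv => ?_
  rw [← dist_eq_zero, ← h.dist_rotVertex, huv, dist_self]

theorem optTour_ge : 4 * (n : ℝ) + 4 * n / √3 - 69 ≤ optTour (modTetrahedron n m) := by
  obtain ⟨σ, hσ, hopt⟩ := (isLeast_optTour (modTetrahedron n m)).1
  rw [hopt]
  have hA := h.corner_bound hσ id (fun _ _ => rfl) Function.surjective_id
  have hC := h.corner_bound hσ h.rotVertex h.dist_rotVertex h.rotVertex_surjective
  have hB := h.corner_bound hσ (h.rotVertex ∘ h.rotVertex)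
    (fun u v => (h.dist_rotVertex _ _).trans (h.dist_rotVertex _ _))
    (h.rotVertex_surjective.comp h.rotVertex_surjective)
  have hM := h.centre_bound hσ
  let c : Fin 4 → Plane := ![sidePt n 0 0, sidePt n 2 0, sidePt n 1 0, segPt n m 0 m]
  let R : Fin 4 → ℝ := ![n / 2, n / 2, n / 2, m * gam n m - n / 2]
  have hside : ∀ s s', s ≠ s' → dist (sidePt n s 0) (sidePt n s' 0) = n := by
    have h0 : ∀ s, dist (sidePt n s 0) (sidePt n (s + 1) 0) = n := by
      intro s
      rw [← sidePt_last, dist_shift (p := fun s => sidePt n s 0) (q := fun s => sidePt n s n)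
        (fun s => rot_sidePt s 0) (fun s => rot_sidePt s n), sub_self,
        dist_corner_sidePt_zero]
    intro s s' hs
    have h1 := h0 s
    have h2 := h0 s'
    rw [dist_comm] at h2
    fin_cases s <;> fin_cases s' <;> first | exact absurd rfl hs | exact h1 | exact h2
  have hcen : ∀ s, dist (sidePt n s 0) (segPt n m 0 m) = m * gam n m := fun s => by
    rw [← h.segPt_centre s, h.dist_corner_segPt_same]
  have hc : ∀ i j, i ≠ j → R i + R j ≤ dist (c i) (c j) := by
    intro i j hij
    fin_cases i <;> fin_cases j <;> first
      | exact absurd rfl hij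
      | (simp only [R, c, Fin.mk_one, Fin.zero_eta, Fin.reduceFinMk, Matrix.cons_val]
         first
         | (rw [hside _ _ (by decide)]; linarith)
         | (rw [hcen]; linarith)
         | (rw [dist_comm, hcen]; linarith))
  have hrot : ∀ s (p : Plane), dist (sidePt n (s + 1) 0) (rot n p) = dist (sidePt n s 0) p :=
    fun s p => by rw [← rot_sidePt, dist_rot]
  have hsum : ∑ v : modTetrahedron n m, ∑ i, moatLength (fun p => dist (c i) p) (R i) (v : Plane) (σ v : Plane) ≤
      ∑ v, dist v (σ v) :=
    Finset.sum_le_sum fun v _ => sum_moatLength_le c R hc _ _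
  rw [Finset.sum_comm, Fin.sum_univ_four] at hsum
  have eA : ∀ v : modTetrahedron n m, dist (sidePt n 0 0) (id v : modTetrahedron n m).1 =
      dist (c 0) v := fun v => rfl
  have eC : ∀ v : modTetrahedron n m, dist (sidePt n 0 0) (h.rotVertex v).1 =
      dist (c 1) v := fun v => hrot 2 v
  have eB : ∀ v : modTetrahedron n m, dist (sidePt n 0 0)
      ((h.rotVertex ∘ h.rotVertex) v).1 = dist (c 2) v := fun v =>
    (hrot 2 _).trans (hrot 1 v)
  simp only [eA] at hA
  simp only [eB] at hB
  simp only [eC] at hC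
  have hm : (n : ℝ) / √3 = m * gam n m := (mul_gam h.m_pos).symm
  have key : 4 * ((n : ℝ) / 2) * 3 + 4 * (m * gam n m - n / 2) -
      3 * ((1 + √3 / 2) * firstRadius n m + 2) - 5 / 2 * gam n m ≤ ∑ v, dist v (σ v) := by
    refine le_trans ?_ hsum
    have hA' : _ ≤ ∑ v : modTetrahedron n m, moatLength (fun p => dist (c 0) p) (R 0) (v : Plane)
      (σ v : Plane) := hA
    have hB' : _ ≤ ∑ v : modTetrahedron n m, moatLength (fun p => dist (c 2) p) (R 2) (v : Plane)
      (σ v : Plane) := hB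
    have hC' : _ ≤ ∑ v : modTetrahedron n m, moatLength (fun p => dist (c 1) p) (R 1) (v : Plane)
      (σ v : Plane) := hC
    have hM' : _ ≤ ∑ v : modTetrahedron n m, moatLength (fun p => dist (c 3) p) (R 3) (v : Plane)
      (σ v : Plane) := hM
    linarith
  refine le_trans ?_ key
  rw [mul_div_assoc, hm]
  have h1 := h.firstRadius_bounds.2
  have h2 := h.gam_le
  have h3 := sqrt_three_bounds
  have h4 := sqrt_three_sq
  nlinarith

end Admissible

end TourLower

/-! ### The subtour LP of the tetrahedron instances -/

section TetrahedronLP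

variable (n m : ℕ)

/-- The six paths into which the vertices are partitioned. -/
def pathPt : Fin 6 → ℕ → Plane :=
  ![sidePt n 0, sidePt n 1, sidePt n 2, fun i => segPt n m 0 (firstIdx n m + i),
    fun i => segPt n m 1 (firstIdx n m + i), fun i => segPt n m 2 (firstIdx n m + i)]

/-- The numbers of edges of the six paths. -/
def pathLen : Fin 6 → ℕ :=
  ![n - 1, n - 1, n - 1, m - firstIdx n m, m - firstIdx n m - 1, m - firstIdx n m - 1]

/-- The distances of consecutive points on the six paths. -/
def pathStep : Fin 6 → ℝ := ![1, 1, 1, gam n m, gam n m, gam n m]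

variable {n m}

namespace Admissible

variable (h : Admissible n m)
include h

theorem gam_le_one : gam n m ≤ 1 := by linarith [h.gam_le, sqrt_three_bounds.2]

theorem one_le_dist_sidePt_segPt (s s' : Fin 3) (i : ℕ) {j : ℕ} (hj : firstIdx n m ≤ j)
    (hj' : j ≤ m) : 1 ≤ dist (sidePt n s i) (segPt n m s' j) := by
  have h1 := h.dist_sidePt_segPt s s' i hj'
  have h2 := (h.firstIdx_le_iff j).mp hj
  linarith

theorem gam_le_dist_same (s : Fin 3) {j j' : ℕ} (hjj : j ≠ j') :
    gam n m ≤ dist (segPt n m s j) (segPt n m s j') := by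
  rw [dist_segPt_same h.m_pos]
  have : (1 : ℤ) ≤ |(j : ℤ) - j'| := Int.one_le_abs (by omega)
  have h2 : (1 : ℝ) ≤ |(j : ℝ) - j'| := by exact_mod_cast this
  nlinarith [h.gam_pos]

theorem gam_le_dist {s s' : Fin 3} (hs : s ≠ s') {j j' : ℕ} (hj : j ≤ m) (hj' : j' ≤ m)
    (hor : j < m ∨ j' < m) : gam n m ≤ dist (segPt n m s j) (segPt n m s' j') := by
  have hg := h.gam_pos
  refine le_of_sq_le_sq ?_ dist_nonneg
  rw [dist_segPt_sq h.m_pos hs]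
  have h1 : (0 : ℝ) ≤ m - j := sub_nonneg.mpr (by exact_mod_cast hj)
  have h2 : (0 : ℝ) ≤ m - j' := sub_nonneg.mpr (by exact_mod_cast hj')
  have h3 : (1 : ℝ) ≤ ((m : ℝ) - j) ^ 2 + ((m : ℝ) - j') ^ 2 + (m - j) * (m - j') := by
    rcases hor with hlt | hlt
    · have : (j : ℝ) + 1 ≤ m := by exact_mod_cast hlt
      nlinarith [mul_nonneg h1 h2, sq_nonneg ((m : ℝ) - j')]
    · have : (j' : ℝ) + 1 ≤ m := by exact_mod_cast hlt
      nlinarith [mul_nonneg h1 h2, sq_nonneg ((m : ℝ) - j)]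
  nlinarith [sq_nonneg (gam n m)]

theorem pathPt_mem {k : Fin 6} {i : ℕ} (hi : i ≤ pathLen n m k) :
    pathPt n m k i ∈ modTetrahedron n m := by
  have h1 := h.firstIdx_lt
  fin_cases k
  · exact h.sidePt_mem 0 (hi.trans (Nat.sub_le _ _))
  · exact h.sidePt_mem 1 (hi.trans (Nat.sub_le _ _))
  · exact h.sidePt_mem 2 (hi.trans (Nat.sub_le _ _))
  · have hi' : i ≤ m - firstIdx n m := hi
    exact h.segPt_mem 0 (by omega) (by omega)
  · have hi' : i ≤ m - firstIdx n m - 1 := hi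
    exact h.segPt_mem 1 (by omega) (by omega)
  · have hi' : i ≤ m - firstIdx n m - 1 := hi
    exact h.segPt_mem 2 (by omega) (by omega)

theorem path_cases (k : Fin 6) :
    (∃ s : Fin 3, k = ![0, 1, 2] s ∧ pathPt n m k = sidePt n s ∧ pathLen n m k = n - 1 ∧
      pathStep n m k = 1) ∨
    (∃ s : Fin 3, k = ![3, 4, 5] s ∧ pathPt n m k = (fun i => segPt n m s (firstIdx n m + i)) ∧
      pathLen n m k ≤ m - firstIdx n m ∧ (s ≠ 0 → pathLen n m k + 1 ≤ m - firstIdx n m) ∧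
      pathStep n m k = gam n m) := by
  have h1 := h.firstIdx_lt
  have h2 : m - firstIdx n m - 1 + 1 ≤ m - firstIdx n m := by omega
  fin_cases k
  · exact Or.inl ⟨0, rfl, rfl, rfl, rfl⟩
  · exact Or.inl ⟨1, rfl, rfl, rfl, rfl⟩
  · exact Or.inl ⟨2, rfl, rfl, rfl, rfl⟩
  · exact Or.inr ⟨0, rfl, rfl, le_rfl, fun hc => absurd rfl hc, rfl⟩
  · exact Or.inr ⟨1, rfl, rfl, Nat.sub_le _ _, fun _ => h2, rfl⟩
  · exact Or.inr ⟨2, rfl, rfl, Nat.sub_le _ _, fun _ => h2, rfl⟩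

theorem pathStep_le_dist {k k' : Fin 6} {i i' : ℕ} (hi : i ≤ pathLen n m k)
    (hi' : i' ≤ pathLen n m k') (hne : k ≠ k' ∨ i ≠ i') :
    pathStep n m k ≤ dist (pathPt n m k i) (pathPt n m k' i') := by
  have h1 := h.firstIdx_lt
  have hn := h.n_ge
  have hg1 := h.gam_le_one
  rcases h.path_cases k with ⟨s, hk, hp, hl, hs⟩ | ⟨s, hk, hp, hl, hl', hs⟩ <;>
    rcases h.path_cases k' with ⟨s', hk', hp', hm, hs'⟩ | ⟨s', hk', hp', hm, hm', hs'⟩ <;>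
    rw [hp, hp', hs]
  · refine one_le_dist_sidePt (by omega) (by omega) (hne.imp_left fun hkk hss => hkk ?_)
    rw [hk, hk', hss]
  · exact h.one_le_dist_sidePt_segPt _ _ _ (by omega) (by omega)
  · rw [dist_comm]
    exact hg1.trans (h.one_le_dist_sidePt_segPt _ _ _ (by omega) (by omega))
  · by_cases hss : s = s'
    · subst hss
      have hii := hne.resolve_left (fun hkk => hkk (hk.trans hk'.symm))
      exact h.gam_le_dist_same _ (by omega)
    · refine h.gam_le_dist hss (by omega) (by omega) ?_
      by_cases hs0 : s = 0
      · have := hm' (fun hc => hss (hs0.trans hc.symm))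
        omega
      · have := hl' hs0
        omega

theorem pathStep_pos (k : Fin 6) : 0 < pathStep n m k := by
  have := h.gam_pos
  fin_cases k <;> simp [pathStep, this]

theorem exists_pathPt {p : Plane} (hp : p ∈ modTetrahedron n m) :
    ∃ k i, i ≤ pathLen n m k ∧ pathPt n m k i = p := by
  have h1 := h.firstIdx_lt
  rcases h.mem_modTetrahedron.mp hp with ⟨s, i, hi, rfl⟩ | ⟨s, j, hj, hjm, rfl⟩
  · have hi' : i ≤ n - 1 := by omega
    fin_cases s
    · exact ⟨0, i, hi', rfl⟩
    · exact ⟨1, i, hi', rfl⟩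
    · exact ⟨2, i, hi', rfl⟩
  · rcases hjm.lt_or_eq with hlt | heq
    · have hj' : j - firstIdx n m ≤ m - firstIdx n m - 1 := by omega
      have hjj : firstIdx n m + (j - firstIdx n m) = j := by omega
      fin_cases s
      · exact ⟨3, j - firstIdx n m, (hj'.trans (Nat.sub_le _ _) :), congrArg (segPt n m 0) hjj⟩
      · exact ⟨4, j - firstIdx n m, hj', congrArg (segPt n m 1) hjj⟩
      · exact ⟨5, j - firstIdx n m, hj', congrArg (segPt n m 2) hjj⟩
    · refine ⟨3, m - firstIdx n m, (le_rfl : m - firstIdx n m ≤ _), ?_⟩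
      rw [heq, h.segPt_centre]
      exact congrArg (segPt n m 0) (by omega)

/-- The vertex at a given point of the plane. -/
def vertex (p : Plane) : modTetrahedron n m :=
  open scoped Classical in
  if hp : p ∈ modTetrahedron n m then ⟨p, hp⟩ else ⟨_, h.sidePt_mem 0 (Nat.zero_le n)⟩

theorem coe_vertex {p : Plane} (hp : p ∈ modTetrahedron n m) : (h.vertex p : Plane) = p := by
  rw [vertex, dif_pos hp]

theorem dist_vertex {p q : Plane} (hp : p ∈ modTetrahedron n m) (hq : q ∈ modTetrahedron n m) :
    dist (h.vertex p) (h.vertex q) = dist p q := by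
  rw [Subtype.dist_eq, h.coe_vertex hp, h.coe_vertex hq]

/-- The vertices, indexed by the path and the position on the path. -/
def vertexEquiv : (Σ k, Fin (pathLen n m k + 1)) ≃ modTetrahedron n m :=
  Equiv.ofBijective (fun z => ⟨pathPt n m z.1 z.2, h.pathPt_mem (Nat.lt_succ_iff.mp z.2.2)⟩) (by
    constructor
    · rintro ⟨k, i⟩ ⟨k', i'⟩ heq
      by_contra hc
      have h1 := h.pathStep_le_dist (Nat.lt_succ_iff.mp i.2) (Nat.lt_succ_iff.mp i'.2)
        (show k ≠ k' ∨ (i : ℕ) ≠ i' by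
          by_contra! hcon
          obtain ⟨rfl, h2⟩ := hcon
          exact hc (by rw [Fin.ext h2]))
      have h2 := congrArg Subtype.val heq
      simp only at h2
      rw [h2, dist_self] at h1
      exact absurd h1 (not_le.mpr (h.pathStep_pos k))
    · rintro ⟨p, hp⟩
      obtain ⟨k, i, hi, rfl⟩ := h.exists_pathPt hp
      exact ⟨⟨k, i, Nat.lt_succ_iff.mpr hi⟩, rfl⟩)

theorem numVertices_eq : (numVertices n m : ℝ) = 3 * n + 3 * (m - firstIdx n m) + 1 := by
  have h1 := h.firstIdx_lt
  have hn := h.n_ge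
  rw [numVertices, ← Fintype.card_coe, ← Fintype.card_congr h.vertexEquiv, Fintype.card_sigma]
  simp only [Fintype.card_fin, Fin.sum_univ_succ]
  simp [pathLen]
  rw [Nat.cast_sub (by omega), Nat.cast_sub (by omega : firstIdx n m ≤ m), Nat.cast_sub (by omega),
    Nat.cast_sub (by omega)]
  push_cast
  ring

theorem three_le_card : 3 ≤ Fintype.card (modTetrahedron n m) := by
  rw [Fintype.card_coe]
  change 3 ≤ numVertices n m
  have h1 := h.numVertices_eq
  have h2 := h.n_real
  have h3 : (firstIdx n m : ℝ) ≤ m := by exact_mod_cast h.firstIdx_lt.le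
  have : (3 : ℝ) ≤ numVertices n m := by linarith
  exact_mod_cast this

theorem optSubtourLP_ge : 3 * (n : ℝ) + 3 * n / √3 - 3 * firstRadius n m + gam n m ≤
    optSubtourLP (modTetrahedron n m) := by
  have h1 := h.firstIdx_lt
  have hn := h.n_ge
  have key := sum_le_optSubtourLP h.three_le_card
    (r := fun v => pathStep n m (h.vertexEquiv.symm v).1) (by
      intro v w hvw
      obtain ⟨⟨k, i⟩, rfl⟩ := h.vertexEquiv.surjective v
      obtain ⟨⟨k', i'⟩, rfl⟩ := h.vertexEquiv.surjective w
      rw [Equiv.symm_apply_apply]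
      refine h.pathStep_le_dist (Nat.lt_succ_iff.mp i.2) (Nat.lt_succ_iff.mp i'.2) ?_
      by_contra! hcon
      obtain ⟨h1, h2⟩ := hcon
      dsimp only at h1 h2
      subst h1
      exact hvw (by rw [Fin.ext h2]))
  refine le_trans (le_of_eq ?_) key
  rw [← Equiv.sum_comp h.vertexEquiv]
  simp only [Equiv.symm_apply_apply]
  rw [Fintype.sum_sigma]
  simp only [Finset.sum_const, Finset.card_univ, Fintype.card_fin, nsmul_eq_mul]
  rw [mul_div_assoc, ← mul_gam h.m_pos, firstRadius]
  simp [Fin.sum_univ_succ, pathLen, pathStep]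
  rw [Nat.cast_sub (by omega), Nat.cast_sub (by omega : firstIdx n m ≤ m), Nat.cast_sub (by omega),
    Nat.cast_sub (by omega)]
  push_cast
  ring

theorem dist_pathPt_succ (k : Fin 6) (i : ℕ) :
    dist (pathPt n m k i) (pathPt n m k (i + 1)) = pathStep n m k := by
  have hside : ∀ s, dist (sidePt n s i) (sidePt n s (i + 1)) = 1 := by
    intro s
    rw [dist_shift (p := fun s => sidePt n s i) (q := fun s => sidePt n s (i + 1))
      (fun s => rot_sidePt s i) (fun s => rot_sidePt s (i + 1)), sub_self]
    change dist (ptC i) (ptC (i + 1)) = 1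
    rw [dist_ptC]
    push_cast
    rw [sub_add_cancel_left, abs_neg, abs_one]
  have hseg : ∀ s j, dist (segPt n m s j) (segPt n m s (j + 1)) = gam n m := by
    intro s j
    rw [dist_segPt_same h.m_pos]
    push_cast
    rw [sub_add_cancel_left, abs_neg, abs_one, one_mul]
  fin_cases k
  · exact hside 0
  · exact hside 1
  · exact hside 2
  · exact hseg 0 _
  · exact hseg 1 _
  · exact hseg 2 _

theorem sidePt_pred (s : Fin 3) : dist (sidePt n s (n - 1)) (sidePt n (s + 1) 0) = 1 := by
  have hn := h.n_ge
  have h1 : n - 1 + 1 = n := by omega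
  rw [← sidePt_last]
  fin_cases s
  · have := h.dist_pathPt_succ 0 (n - 1)
    rw [h1] at this
    exact this
  · have := h.dist_pathPt_succ 1 (n - 1)
    rw [h1] at this
    exact this
  · have := h.dist_pathPt_succ 2 (n - 1)
    rw [h1] at this
    exact this

theorem corner_triangle (s : Fin 3) {p q r : Plane} (hp : p = sidePt n (s + 1) 0)
    (hq : q = sidePt n s (n - 1)) (hr : r = segPt n m (s + 1) (firstIdx n m)) :
    dist p q + dist q r + dist r p ≤ 2 + 2 * firstRadius n m := by
  subst hp hq hr
  have h1 := h.sidePt_pred s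
  have h2 := h.dist_corner_segPt_same (s + 1) (firstIdx n m)
  have h3 := dist_triangle (sidePt n s (n - 1)) (sidePt n (s + 1) 0)
    (segPt n m (s + 1) (firstIdx n m))
  rw [dist_comm (sidePt n (s + 1) 0) (sidePt n s (n - 1)),
    dist_comm (segPt n m (s + 1) (firstIdx n m)) (sidePt n (s + 1) 0)]
  unfold firstRadius
  linarith

theorem optSubtourLP_le_lengths :
    optSubtourLP (modTetrahedron n m) ≤ 3 * (n : ℝ) + 3 * n / √3 := by
  have hk := h.firstIdx_lt
  have hn := h.n_ge
  have hg := h.gam_pos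
  rcases Nat.lt_or_ge (m - firstIdx n m - 1) 1 with hsmall | hlarge
  · exfalso
    have hmk : (m : ℝ) ≤ firstIdx n m + 1 := by exact_mod_cast (by omega : m ≤ firstIdx n m + 1)
    have h2 := mul_le_mul_of_nonneg_right hmk hg.le
    have h3 := h.firstRadius_lt
    have h4 := h.m_gam_ge
    have h5 := h.n_real
    unfold firstRadius at h3
    linarith [h.gam_le_one]
  have key := optSubtourLP_le_sixPaths h.three_le_card (pathLen n m) (by
      intro k
      fin_cases k <;> simp [pathLen] <;> omega)
    (fun k i => h.vertex (pathPt n m k i)) (by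
      rintro ⟨p, hp⟩
      obtain ⟨k, i, hi, rfl⟩ := h.exists_pathPt hp
      exact ⟨k, i, hi, Subtype.ext (h.coe_vertex hp)⟩) (by
      intro k i k' i' hi hi' heq
      by_contra hc
      have h1 := h.pathStep_le_dist hi hi' (by tauto)
      rw [← h.dist_vertex (h.pathPt_mem hi) (h.pathPt_mem hi'), heq, dist_self] at h1
      exact absurd h1 (not_le.mpr (h.pathStep_pos k)))
  refine key.trans ?_
  have hsum : ∀ k, ∑ i : Fin (pathLen n m k), dist (h.vertex (pathPt n m k i))
      (h.vertex (pathPt n m k (i + 1))) = pathLen n m k * pathStep n m k := by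
    intro k
    have hi : ∀ i : Fin (pathLen n m k), dist (h.vertex (pathPt n m k i))
        (h.vertex (pathPt n m k (i + 1))) = pathStep n m k := fun i =>
      (h.dist_vertex (h.pathPt_mem i.2.le) (h.pathPt_mem i.2)).trans (h.dist_pathPt_succ k i)
    rw [Finset.sum_congr rfl fun i _ => hi i]
    simp
  have hv : ∀ q r, dist
      (h.vertex (pathPt n m (triangleEnd q r).1
        (if (triangleEnd q r).2 then pathLen n m (triangleEnd q r).1 else 0)))
      (h.vertex (pathPt n m (triangleEnd q (r + 1)).1
        (if (triangleEnd q (r + 1)).2 then pathLen n m (triangleEnd q (r + 1)).1 else 0))) =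
      dist (pathPt n m (triangleEnd q r).1
        (if (triangleEnd q r).2 then pathLen n m (triangleEnd q r).1 else 0))
      (pathPt n m (triangleEnd q (r + 1)).1
        (if (triangleEnd q (r + 1)).2 then pathLen n m (triangleEnd q (r + 1)).1 else 0)) :=
    fun q r => h.dist_vertex (h.pathPt_mem (by split_ifs <;> omega))
      (h.pathPt_mem (by split_ifs <;> omega))
  simp only [hsum, hv]
  have hA := h.corner_triangle 2 (p := sidePt n 0 0) rfl rfl rfl
  have hB := h.corner_triangle 0 (p := sidePt n 1 0) rfl rfl rfl
  have hC := h.corner_triangle 1 (p := sidePt n 2 0) rfl rfl rfl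
  have hM : dist (segPt n m 0 m) (segPt n m 1 (m - 1)) +
      dist (segPt n m 1 (m - 1)) (segPt n m 2 (m - 1)) +
      dist (segPt n m 2 (m - 1)) (segPt n m 0 m) ≤ 4 * gam n m := by
    have h1 : ∀ s, dist (segPt n m 0 m) (segPt n m s (m - 1)) = gam n m := fun s => by
      rw [h.dist_centre_segPt s (Nat.sub_le _ _), Nat.sub_sub_self (by omega)]
      simp
    have h2 := dist_triangle_left (segPt n m 1 (m - 1)) (segPt n m 2 (m - 1)) (segPt n m 0 m)
    rw [dist_comm (segPt n m 2 (m - 1)), h1, h1]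
    rw [h1, h1] at h2
    linarith
  have e1 : firstIdx n m + (m - firstIdx n m) = m := by omega
  have e2 : firstIdx n m + (m - firstIdx n m - 1) = m - 1 := by omega
  rw [mul_div_assoc, ← mul_gam h.m_pos]
  unfold firstRadius at hA hB hC
  simp [Fin.sum_univ_succ, pathLen, pathStep, pathPt, triangleEnd, e1, e2] at hA hB hC hM ⊢
  rw [Nat.cast_sub (by omega), Nat.cast_sub (by omega : firstIdx n m ≤ m), Nat.cast_sub (by omega),
    Nat.cast_sub (by omega)]
  push_cast
  linarith

end Admissible

end TetrahedronLP

/-! ### The upper bound for tours of the tetrahedron instances -/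

section TourUpper

variable {n m : ℕ}

theorem dist_sidePt_succ (s : Fin 3) (i : ℕ) :
    dist (sidePt n s i) (sidePt n s (i + 1)) = 1 := by
  rw [dist_shift (p := fun s => sidePt n s i) (q := fun s => sidePt n s (i + 1))
    (fun s => rot_sidePt s i) (fun s => rot_sidePt s (i + 1)), sub_self]
  change dist (ptC i) (ptC (i + 1)) = 1
  rw [dist_ptC]
  simp

namespace Admissible

variable (h : Admissible n m)
include h

theorem corner_shortcut_sq :
    (√3 / 2 * firstRadius n m - 9) ^ 2 + (firstRadius n m / 2) ^ 2 ≤ 6 ^ 2 := by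
  have h1 := h.firstRadius_bounds
  have h2 := sqrt_three_bounds
  have h3 := sqrt_three_sq
  have h4 : (√3 / 2 * firstRadius n m - 9) ^ 2 + (firstRadius n m / 2) ^ 2 =
      firstRadius n m ^ 2 - 9 * (√3 * firstRadius n m) + 81 := by
    linear_combination (firstRadius n m ^ 2 / 4) * h3
  have h5 : 1.732 * firstRadius n m ≤ √3 * firstRadius n m :=
    mul_le_mul_of_nonneg_right h2.1.le (by linarith)
  have h6 : 0 ≤ (firstRadius n m - 10) * (11 - firstRadius n m) :=
    mul_nonneg (by linarith) (by linarith)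
  rw [h4]
  linarith

theorem dist_sidePt_segPt_zero_le :
    dist (sidePt n 0 9) (segPt n m 0 (firstIdx n m)) ≤ 6 := by
  refine le_of_sq_le_sq ?_ (by norm_num)
  change dist (ptC 9) (ptE n m _) ^ 2 ≤ _
  rw [dist_sq_plane, ptC_zero, ptC_one, ptE_zero h.m_pos, ptE_one h.m_pos]
  refine le_trans (le_of_eq ?_) h.corner_shortcut_sq
  rw [firstRadius]
  push_cast
  ring

theorem dist_segPt_sidePt_one_le :
    dist (segPt n m 1 (firstIdx n m)) (sidePt n 0 (n - 9)) ≤ 6 := by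
  have hn := h.n_ge
  refine le_of_sq_le_sq ?_ (by norm_num)
  change dist (ptF n m _) (ptC (n - 9)) ^ 2 ≤ _
  rw [dist_sq_plane, ptC_zero, ptC_one, ptF_zero h.m_pos, ptF_one h.m_pos,
    Nat.cast_sub (by omega)]
  refine le_trans (le_of_eq ?_) h.corner_shortcut_sq
  rw [firstRadius]
  push_cast
  ring

theorem optTour_le :
    optTour (modTetrahedron n m) ≤ 4 * n + 4 * n / √3 - 4 * firstRadius n m - 8 := by
  have hn := h.n_ge
  have hk := h.firstIdx_lt.le
  have hg := h.gam_pos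
  set k := firstIdx n m with hkdef
  have hside : ∀ s i, i < n → dist (h.vertex (sidePt n s i)) (h.vertex (sidePt n s (i + 1))) = 1 :=
    fun s i hi => by
      rw [h.dist_vertex (h.sidePt_mem s hi.le) (h.sidePt_mem s hi), dist_sidePt_succ]
  have hseg : ∀ s j, k ≤ j → j < m →
      dist (h.vertex (segPt n m s j)) (h.vertex (segPt n m s (j + 1))) = gam n m :=
    fun s j hj hj' => by
      rw [h.dist_vertex (h.segPt_mem s hj hj'.le) (h.segPt_mem s (by omega) hj'),
        dist_segPt_same h.m_pos]
      push_cast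
      simp
  have hup : ∀ i < m - k, dist (h.vertex (segPt n m 0 (k + i))) (h.vertex (segPt n m 0 (k + (i + 1))))
      = gam n m := fun i hi => hseg 0 (k + i) (by omega) (by omega)
  have hdown : ∀ s, ∀ i < m - k, dist (h.vertex (segPt n m s (m - i)))
      (h.vertex (segPt n m s (m - (i + 1)))) = gam n m := fun s i hi => by
    rw [dist_comm, ← hseg s (m - (i + 1)) (by omega) (by omega)]
    congr 3
    omega
  have htour := optTour_le_walkLength (h.vertex (segPt n m 0 k))
    ((List.range (m - k + 1)).map (fun i => h.vertex (segPt n m 0 (k + i))) ++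
    ((List.range (m - k + 1)).map (fun i => h.vertex (segPt n m 2 (m - i))) ++
    ((List.range (m - k + 1)).map (fun i => h.vertex (segPt n m 1 (m - i))) ++
    ((List.range (9 + 1)).map (fun i => h.vertex (sidePt n 0 (n - 9 + i))) ++
    ((List.range (n + 1)).map (fun i => h.vertex (sidePt n 1 i)) ++
    ((List.range (n + 1)).map (fun i => h.vertex (sidePt n 2 i)) ++
    (List.range (n - 10 + 1)).map (fun i => h.vertex (sidePt n 0 i)))))))) ?_
  · simp only [List.append_assoc] at htour
    rw [walkLength_map_range _ _ _ _ hup, walkLength_map_range _ _ _ _ (hdown 2),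
      walkLength_map_range _ _ _ _ (hdown 1),
      walkLength_map_range _ _ _ _ (fun i hi => hside 0 (n - 9 + i) (by omega)),
      walkLength_map_range _ _ _ _ (fun i hi => hside 1 i hi),
      walkLength_map_range _ _ _ _ (fun i hi => hside 2 i hi),
      walkLength_map_range _ _ _ _ (fun i hi => hside 0 i (by omega))] at htour
    simp only [walkLength, Nat.add_zero, Nat.sub_zero, dist_self, Nat.sub_sub_self hk,
      Nat.add_sub_cancel' hk, Nat.sub_add_cancel (show 9 ≤ n by omega)] at htour
    have e1 : dist (h.vertex (segPt n m 0 m)) (h.vertex (segPt n m 2 m)) = 0 := by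
      rw [h.segPt_centre 2, dist_self]
    have e2 : dist (h.vertex (segPt n m 2 k)) (h.vertex (segPt n m 1 m)) =
        ((m : ℝ) - k) * gam n m := by
      rw [h.segPt_centre 1, ← h.segPt_centre 2, h.dist_vertex (h.segPt_mem 2 le_rfl hk)
        (h.segPt_mem 2 hk le_rfl), dist_segPt_same h.m_pos, abs_sub_comm, abs_of_nonneg]
      exact sub_nonneg.mpr (by exact_mod_cast hk)
    have e3 : dist (h.vertex (segPt n m 1 k)) (h.vertex (sidePt n 0 (n - 9))) ≤ 6 := by
      rw [h.dist_vertex (h.segPt_mem 1 le_rfl hk) (h.sidePt_mem 0 (Nat.sub_le _ _))]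
      exact h.dist_segPt_sidePt_one_le
    have e4 : ∀ s, dist (h.vertex (sidePt n s n)) (h.vertex (sidePt n (s + 1) 0)) = 0 := fun s => by
      rw [sidePt_last, dist_self]
    have e5 : dist (h.vertex (sidePt n 0 (n - 10))) (h.vertex (segPt n m 0 k)) ≤ n - 13 := by
      rw [h.dist_vertex (h.sidePt_mem 0 (Nat.sub_le _ _)) (h.segPt_mem 0 le_rfl hk)]
      refine (dist_triangle _ (sidePt n 0 9) _).trans ?_
      have h1 := h.dist_sidePt_segPt_zero_le
      have h2 : dist (sidePt n 0 (n - 10)) (sidePt n 0 9) = n - 19 := by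
        change dist (ptC (n - 10)) (ptC 9) = _
        have := h.n_real
        rw [dist_ptC, Nat.cast_sub (by omega), abs_of_nonneg]
        · push_cast
          ring
        · push_cast
          linarith
      linarith
    have e40 := e4 0
    have e41 := e4 1
    have e42 := e4 2
    have hm : (n : ℝ) / √3 = m * gam n m := (mul_gam h.m_pos).symm
    have hρ : firstRadius n m = k * gam n m := rfl
    rw [Nat.cast_sub hk, Nat.cast_sub (show 10 ≤ n by omega), e1, e2] at htour
    simp only [Fin.isValue, Fin.reduceAdd] at e40 e41 e42
    push_cast at htour
    rw [mul_div_assoc, hm, hρ]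
    linarith
  · intro v
    right
    have hv : ∀ p, (v : Plane) = p → v = h.vertex p := fun p hp => by
      subst hp
      exact Subtype.ext (h.coe_vertex v.2).symm
    simp only [List.mem_append, List.mem_map, List.mem_range]
    rcases h.mem_modTetrahedron.mp v.2 with ⟨s, i, hi, hp⟩ | ⟨s, j, hj, hjm, hp⟩
    · have := hv _ hp
      fin_cases s
      · by_cases hi' : i ≤ n - 10
        · exact Or.inr (Or.inr (Or.inr (Or.inr (Or.inr (Or.inr ⟨i, by omega, this.symm⟩)))))
        · refine Or.inr (Or.inr (Or.inr (Or.inl ⟨i - (n - 9), by omega, ?_⟩)))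
          rw [Nat.add_sub_cancel' (by omega)]
          exact this.symm
      · exact Or.inr (Or.inr (Or.inr (Or.inr (Or.inl ⟨i, by omega, this.symm⟩))))
      · exact Or.inr (Or.inr (Or.inr (Or.inr (Or.inr (Or.inl ⟨i, by omega, this.symm⟩)))))
    · have := hv _ hp
      fin_cases s
      · refine Or.inl ⟨j - k, by omega, ?_⟩
        rw [Nat.add_sub_cancel' hj]
        exact this.symm
      · refine Or.inr (Or.inr (Or.inl ⟨m - j, by omega, ?_⟩))
        rw [Nat.sub_sub_self hjm]
        exact this.symm
      · refine Or.inr (Or.inl ⟨m - j, by omega, ?_⟩)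
        rw [Nat.sub_sub_self hjm]
        exact this.symm

end Admissible

end TourUpper

/-! ### The integrality ratio of the tetrahedron instances -/

section Ratio

variable {n m : ℕ}

theorem modRatio_eq : modRatio n m =
    optTour (modTetrahedron n m) / optSubtourLP (modTetrahedron n m) := rfl

namespace Admissible

variable (h : Admissible n m)
include h

theorem div_sqrt_three_bounds : n * 0.577 ≤ (n : ℝ) / √3 ∧ (n : ℝ) / √3 ≤ n * 0.578 := by
  have h1 := h.n_pos
  have h2 := sqrt_three_bounds
  rw [le_div_iff₀ (by positivity), div_le_iff₀ (by positivity)]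
  constructor <;> nlinarith

theorem lp_lower_pos : 0 < 3 * (n : ℝ) + 3 * n / √3 - 33 := by
  rw [mul_div_assoc]
  linarith [h.n_real, h.div_sqrt_three_bounds.1]

theorem lp_lower_le : 3 * (n : ℝ) + 3 * n / √3 - 33 ≤ optSubtourLP (modTetrahedron n m) := by
  linarith [h.optSubtourLP_ge, h.firstRadius_lt, h.gam_le_one, h.gam_pos]

theorem optSubtourLP_pos : 0 < optSubtourLP (modTetrahedron n m) :=
  h.lp_lower_pos.trans_le h.lp_lower_le

theorem le_modRatio :
    (4 * n + 4 * n / √3 - 69) / (3 * n + 3 * n / √3) ≤ modRatio n m := by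
  have h1 := h.div_sqrt_three_bounds.1
  have h2 := h.optTour_ge
  have h3 := h.n_real
  have h4 : 0 ≤ 4 * (n : ℝ) + 4 * n / √3 - 69 := by
    rw [mul_div_assoc]
    linarith
  exact div_le_div₀ (h4.trans h2) h2 h.optSubtourLP_pos h.optSubtourLP_le_lengths

theorem modRatio_le :
    modRatio n m ≤ (4 * n + 4 * n / √3 - 17) / (3 * n + 3 * n / √3 - 33) := by
  have h1 := h.div_sqrt_three_bounds.1
  have h2 := h.optTour_le
  have h3 := h.n_real
  have h4 := h.ten_le_firstRadius
  have h5 : 0 ≤ 4 * (n : ℝ) + 4 * n / √3 - 17 := by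
    rw [mul_div_assoc]
    linarith
  exact div_le_div₀ h5 (by linarith) h.lp_lower_pos h.lp_lower_le

theorem one_div_le_gap : 1 / (n : ℝ) ≤ 4 / 3 - modRatio n m := by
  have h1 := h.div_sqrt_three_bounds.2
  have h2 := h.optTour_le
  have h3 := h.optSubtourLP_ge
  have h4 := h.gam_pos
  have h5 := h.n_pos
  have h6 := h.optSubtourLP_pos
  have h7 := h.optSubtourLP_le_lengths
  rw [mul_div_assoc] at h2 h3 h7
  rw [modRatio_eq, le_sub_iff_add_le, ← le_sub_iff_add_le', div_le_iff₀ h6, sub_mul,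
    one_div_mul_eq_div, le_sub_iff_add_le, ← le_sub_iff_add_le', div_le_iff₀ h5]
  nlinarith

theorem gap_le : 4 / 3 - modRatio n m ≤ 23 / n := by
  have h1 := h.div_sqrt_three_bounds.1
  have h2 := h.le_modRatio
  have h5 := h.n_pos
  have h6 : 4 / 3 - 23 / (n : ℝ) ≤ (4 * n + 4 * n / √3 - 69) / (3 * n + 3 * n / √3) := by
    rw [mul_div_assoc, mul_div_assoc, le_div_iff₀ (by positivity)]
    have h7 : 23 / (n : ℝ) * n = 23 := by field_simp
    have h8 : 0 ≤ 23 / (n : ℝ) * (n / √3) := by positivity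
    linarith
  linarith

theorem le_numVertices : (n : ℝ) ≤ numVertices n m := by
  have h1 : (firstIdx n m : ℝ) < m := by exact_mod_cast h.firstIdx_lt
  rw [h.numVertices_eq]
  linarith [h.n_pos]

theorem numVertices_le : (numVertices n m : ℝ) ≤ 4 * n + 3 * m := by
  have h1 : (0 : ℝ) ≤ firstIdx n m := Nat.cast_nonneg _
  rw [h.numVertices_eq]
  linarith [h.n_real]

end Admissible

theorem tendsto_modRatio : Tendsto (fun p : ℕ × ℕ => modRatio p.1 p.2)
    (comap Prod.fst atTop ⊓ 𝓟 {p : ℕ × ℕ | (p.1 : ℝ) ≤ 3 / 2 * p.2}) (𝓝 (4 / 3)) := by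
  have hn : Tendsto (fun p : ℕ × ℕ => (p.1 : ℝ))
      (comap Prod.fst atTop ⊓ 𝓟 {p : ℕ × ℕ | (p.1 : ℝ) ≤ 3 / 2 * p.2}) atTop :=
    tendsto_natCast_atTop_atTop.comp (tendsto_comap.mono_left inf_le_left)
  have hadm : ∀ᶠ p : ℕ × ℕ in comap Prod.fst atTop ⊓ 𝓟 {p : ℕ × ℕ | (p.1 : ℝ) ≤ 3 / 2 * p.2},
      Admissible p.1 p.2 := by
    filter_upwards [hn.eventually_ge_atTop 40, mem_inf_of_right (mem_principal_self _)] with p h1 h2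
    have h2' : (p.1 : ℝ) ≤ 3 / 2 * p.2 := h2
    refine ⟨by exact_mod_cast h1, ?_, h2'⟩
    have : (22 : ℝ) ≤ p.2 := by linarith
    exact_mod_cast this
  have h0 : ∀ a : ℝ, Tendsto (fun p : ℕ × ℕ => 4 / 3 - a / (p.1 : ℝ))
      (comap Prod.fst atTop ⊓ 𝓟 {p : ℕ × ℕ | (p.1 : ℝ) ≤ 3 / 2 * p.2}) (𝓝 (4 / 3)) := fun a => by
    simpa using tendsto_const_nhds.sub (hn.const_div_atTop a)
  refine tendsto_of_tendsto_of_tendsto_of_le_of_le' (h0 23) (h0 1) ?_ ?_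
  · filter_upwards [hadm] with p hp
    linarith [hp.gap_le]
  · filter_upwards [hadm] with p hp
    linarith [hp.one_div_le_gap]

end Ratio

end TSP

end

theorem mainTheorem2 :
    -- the two bounds
    (∀ n m : ℕ, 40 ≤ n → 22 ≤ m → (n : ℝ) ≤ 3 / 2 * m →
      (4 * n + 4 * n / √3 - 69) / (3 * n + 3 * n / √3) ≤ TSP.modRatio n m ∧
      TSP.modRatio n m ≤ (4 * n + 4 * n / √3 - 17) / (3 * n + 3 * n / √3 - 33)) ∧
    -- convergence to `4/3` as `n → ∞`, uniformly over all `m` with `n ≤ 3/2 * m`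
    Tendsto (fun p : ℕ × ℕ => TSP.modRatio p.1 p.2)
      (comap Prod.fst atTop ⊓ 𝓟 {p : ℕ × ℕ | (p.1 : ℝ) ≤ 3 / 2 * p.2}) (𝓝 (4 / 3)) ∧
    -- the rate in terms of `n`
    (∃ c C : ℝ, 0 < c ∧ 0 < C ∧ ∀ n m : ℕ, 40 ≤ n → 22 ≤ m → (n : ℝ) ≤ 3 / 2 * m →
      c / n ≤ 4 / 3 - TSP.modRatio n m ∧ 4 / 3 - TSP.modRatio n m ≤ C / n) ∧
    -- the rate in terms of the number of vertices, as long as `m = O(n)`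
    (∀ κ : ℝ, ∃ c C : ℝ, 0 < c ∧ 0 < C ∧
      ∀ n m : ℕ, 40 ≤ n → 22 ≤ m → (n : ℝ) ≤ 3 / 2 * m → (m : ℝ) ≤ κ * n →
        c / TSP.numVertices n m ≤ 4 / 3 - TSP.modRatio n m ∧
        4 / 3 - TSP.modRatio n m ≤ C / TSP.numVertices n m) := by
  refine ⟨fun n m h1 h2 h3 => ?_, TSP.tendsto_modRatio, ⟨1, 23, one_pos, by norm_num,
    fun n m h1 h2 h3 => ?_⟩, fun κ => ⟨1, 23 * (4 + 3 * |κ|), one_pos, by positivity,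
    fun n m h1 h2 h3 hκ => ?_⟩⟩ <;> have h : TSP.Admissible n m := ⟨h1, h2, h3⟩
  · exact ⟨h.le_modRatio, h.modRatio_le⟩
  · exact ⟨h.one_div_le_gap, h.gap_le⟩
  · have hn := h.n_pos
    have hN := h.le_numVertices
    refine ⟨(one_div_le_one_div_of_le hn hN).trans h.one_div_le_gap, h.gap_le.trans ?_⟩
    rw [div_le_div_iff₀ hn (hn.trans_le hN)]
    have h4 : (m : ℝ) ≤ |κ| * n := hκ.trans (mul_le_mul_of_nonneg_right (le_abs_self κ) hn.le)
    linarith [h.numVertices_le]
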